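/- Let $A,B,C$ be finite sets, $A\neq\emptyset$, and let $\theta$ be a finite non-empty index set. A compound wiretap channel $\mathfrak W$ is a family of pairs of stochastic matrices $W_t:A\to\mathcal P(B)$ (to the legitimate receiver) and $V_t:A\to\mathcal P(C)$ (to the eavesdropper), $t\in\theta$; let $W_t^{\otimes n},V_t^{\otimes n}$ be their $n$-th memoryless extensions. An $(n,J_n)$ code without channel state information (CSI) consists of a stochastic encoder $E:\{1,\dots,J_n\}\to\mathcal P(A^n)$ and mutually disjoint decoding sets $D_j\subset B^n$, $1\le j\le J_n$ (with $J_n\ge1$), none of which depends on $t$. A number $R\ge 0$ is an achievable secrecy rate if there is a sequence of $(n,J_n)$ codes, $n\in\mathbb N$, with $$\lim_{n\to\infty}\max_{t}\max_{j}\sum_{x^n\in A^n}E(x^n|j)\,W_t^{\otimes n}(D_j^c|x^n)=0,\qquad \liminf_{n\to\infty}\tfrac1n\log_2 J_n\ge R,\qquad \lim_{n\to\infty}\max_{t}I(J;Z_t^n)=0,$$ where $J$ is uniformly distributed on $\{1,\dots,J_n\}$ and $Z_t^n$ is the resulting output of $V_t^{\otimes n}$. The secrecy capacity $C_S(\mathfrak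 W)$ without CSI is the largest achievable secrecy rate. Mutual information is measured in bits. Theorem. The secrecy capacity $C_S(\mathfrak W)$ (the largest achievable secrecy rate) exists, and $$C_S(\mathfrak W)\ \ge\ \max_{U\to X\to Y_tZ_t}\Big(\min_{t\in\theta}I(U;Y_t)-\max_{t\in\theta}I(U;Z_t)\Big),$$ where the maximum exists and is over all random variables $U$ with finitely many values and $X$ with values in $A$ such that, for every $t$, $U\to X\to Y_tZ_t$ is a Markov chain and $X$ is connected to $Y_t$ via $W_t$ and to $Z_t$ via $V_t$. Moreover, for every $n$ the maximum in the following display (over $U$ with finitely many values and $X$ with values in $A^n$, where $Y_t^n,Z_t^n$ are the outputs of $W_t^{\otimes n},V_t^{\otimes n}$ for the input $X$) exists, the limit exists and is finite, and $$C_S(\mathfrak W)\ \ge\ \lim_{n\to\infty}\frac1n\max_{U\to X\to Y_t^nZ_t^n}\Big(\min_{t\in\theta}I(U;Y_t^n)-\max_{t\in\theta}I(U;Z_t^n)\Big).$$ Conversely, $$C_S(\mathfrak W)\ \le\ \lim_{n\to\infty}\frac1n\max_{U\to X\to Y_t^nZ_t^n}\Big(\min_{t\in\theta}I(U;Y_t^n)-\max_{t\in\theta}I(U;Z_t^n)\Big).$$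 -/

import Mathlib

namespace CompoundWiretap

open Finset

/-- `𝒫 α`: the probability distributions on the finite set `α`. -/
abbrev Dist (α : Type*) [Fintype α] : Type _ := stdSimplex ℝ α

/-- A channel (stochastic matrix) from `α` to `β`; `W a b` is the probability `W(b | a)`. -/
abbrev Channel (α β : Type*) [Fintype β] : Type _ := α → Dist β

/-- The `n`-th memoryless extension `W^{⊗ n}(y^n | x^n) = ∏ i, W(y_i | x_i)`. -/
noncomputable def memoryless {α β : Type*} [Fintype β] (W : Channel α β) (n : ℕ) :
    Channel (Fin n → α) (Fin n → β) := fun x =>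
  ⟨fun y => ∏ i, W (x i) (y i), by
    classical
    refine ⟨fun y => Finset.prod_nonneg fun i _ => (W (x i)).2.1 (y i), ?_⟩
    have h := Finset.prod_univ_sum (fun _ : Fin n => (Finset.univ : Finset β))
      (fun i b => W (x i) b)
    rw [Fintype.piFinset_univ] at h
    rw [← h]
    exact Finset.prod_eq_one fun i _ => (W (x i)).2.2⟩

/-- The mutual information, in bits, of two random variables with joint probability mass
function `P`. Terms with `P u y = 0` vanish, and where `P u y > 0` both marginals are positive. -/
noncomputable def mutualInfo {υ β : Type*} [Fintype υ] [Fintype β] (P : υ → β → ℝ) : ℝ :=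
  ∑ u, ∑ y, P u y * Real.logb 2 (P u y / ((∑ y', P u y') * ∑ u', P u' y))

/-- The joint law of `(U, Y)` when `(U, X)` has law `P`, `U → X → Y` is a Markov chain and `X` is
connected to `Y` via `W`. -/
noncomputable def outputLaw {υ α β : Type*} [Fintype υ] [Fintype α] [Fintype β]
    (P : Dist (υ × α)) (W : Channel α β) : υ → β → ℝ :=
  fun u y => ∑ x, P (u, x) * W x y

section Compound

variable {θ A B C : Type*} [Fintype θ] [Fintype A] [Fintype B] [Fintype C]

/-- `min_t I(U; Y_t) - max_t I(U; Z_t)` for `U → X → Y_t Z_t` with `(U, X)` of law `P`. -/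
noncomputable def rateGap {υ : Type*} [Fintype υ] (W : θ → Channel A B) (V : θ → Channel A C)
    (P : Dist (υ × A)) : ℝ :=
  (⨅ t, mutualInfo (outputLaw P (W t))) - ⨆ t, mutualInfo (outputLaw P (V t))

/-- All values of `min_t I(U; Y_t) - max_t I(U; Z_t)`, where `U` ranges over the random variables
with finitely many values and `U → X → Y_t Z_t`. -/
def rateGaps (W : θ → Channel A B) (V : θ → Channel A C) : Set ℝ :=
  {r | ∃ (k : ℕ) (P : Dist (Fin k × A)), r = rateGap W V P}

/-- The values of `min_t I(U; Y_t^n) - max_t I(U; Z_t^n)` for the `n`-th memoryless extensions. -/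
def blockRateGaps (W : θ → Channel A B) (V : θ → Channel A C) (n : ℕ) : Set ℝ :=
  rateGaps (fun t => memoryless (W t) n) (fun t => memoryless (V t) n)

/-- An `(n, J)` code without channel state information: a stochastic encoder and mutually disjoint
decoding sets, neither of which depends on the channel index. -/
structure Code (A B : Type*) [Fintype A] (n J : ℕ) where
  /-- the stochastic encoder -/
  enc : Channel (Fin J) (Fin n → A)
  /-- the decoding sets -/
  dec : Fin J → Finset (Fin n → B)
  disjoint : ∀ i j, i ≠ j → Disjoint (dec i) (dec j)

/-- The maximum error probability
`max_t max_j ∑_{x^n} E(x^n | j) W_t^{⊗ n}(D_j^c | x^n)`. -/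
noncomputable def Code.error [DecidableEq B] {n J : ℕ} (c : Code A B n J)
    (W : θ → Channel A B) : ℝ :=
  ⨆ t, ⨆ j, ∑ x, c.enc j x * ∑ y ∈ (c.dec j)ᶜ, memoryless (W t) n x y

/-- The joint law of `(J, Z^n)`: the message `J` is uniformly distributed, it is encoded, and the
codeword is sent through the memoryless extension of the eavesdropper's channel `V`. -/
noncomputable def Code.leakLaw {n J : ℕ} (c : Code A B n J) (V : Channel A C) :
    Fin J → (Fin n → C) → ℝ :=
  fun j z => (1 / (J : ℝ)) * ∑ x, c.enc j x * memoryless V n x z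

/-- The leaked information `max_t I(J; Z_t^n)`. -/
noncomputable def Code.leakage {n J : ℕ} (c : Code A B n J) (V : θ → Channel A C) : ℝ :=
  ⨆ t, mutualInfo (c.leakLaw (V t))

/-- `R` is an achievable secrecy rate, with strong secrecy and without channel state information
at the transmitter or the legitimate receiver. -/
def IsAchievable [DecidableEq B] (W : θ → Channel A B) (V : θ → Channel A C) (R : ℝ) : Prop :=
  0 ≤ R ∧ ∃ (J : ℕ → ℕ) (c : ∀ n, Code A B n (J n)),
    (∀ n, 0 < J n) ∧
    Filter.Tendsto (fun n => (c n).error W) Filter.atTop (nhds 0) ∧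
    (R : EReal) ≤ Filter.liminf (fun n : ℕ => ((1 / (n : ℝ) * Real.logb 2 (J n) : ℝ) : EReal))
      Filter.atTop ∧
    Filter.Tendsto (fun n => (c n).leakage V) Filter.atTop (nhds 0)

/-- The secrecy capacity without channel state information. -/
noncomputable def secrecyCapacity [DecidableEq B] (W : θ → Channel A B) (V : θ → Channel A C) :
    ℝ :=
  sSup {R | IsAchievable W V R}

end Compound

end CompoundWiretap

/-!
Take a random codebook of about `e ^ (n r)` rows of about `e ^ (n s)` words, drawn independently
from the law of `U ^ n`; a message is sent as a uniformly chosen word of its row, through the prefix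
channel from `U` to `X`. If `r + s < min_t I(U; Y_t)`, a likelihood-ratio test passed as soon as one
state of the channel makes the word likely decodes without knowledge of the state, because the
number of states is bounded. If `s > max_t I(U; Z_t)`, the mean relative entropy between the
eavesdropper's output for a row and the output law for `U ^ n` decays exponentially. This relative
entropy bounds the leakage, which gives strong secrecy, and dropping the worse half of the rows
turns means over the messages into maxima.

Applied to blocks of length `m`, this shows that every `m`-letter gap divided by `m` is at most the
capacity. By Fano's inequality, a good code with `U` its uniform message has a gap of almost its
rate. The normalised block maxima therefore converge to the capacity. These maxima are attained:
by Carathéodory's theorem `U` needs only a bounded number of values, so that they are maxima over a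
compact set.
-/

namespace CompoundWiretap

open Finset

namespace Dist

variable {α β γ : Type*} [Fintype α] [Fintype β] [Fintype γ]

/-! ### Expectations and probabilities -/

/-- The expectation `∑ a, μ(a) F(a)`. -/
noncomputable def expect (μ : Dist α) (F : α → ℝ) : ℝ := ∑ a, μ a * F a

lemma expect_mono {μ : Dist α} {F G : α → ℝ} (h : ∀ a, 0 < μ a → F a ≤ G a) :
    μ.expect F ≤ μ.expect G := by
  refine sum_le_sum fun a _ => ?_
  rcases (stdSimplex.zero_le μ a).eq_or_lt with h0 | h0
  · rw [← h0, zero_mul, zero_mul]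
  · exact mul_le_mul_of_nonneg_left (h a h0) h0.le

lemma expect_congr {μ : Dist α} {F G : α → ℝ} (h : ∀ a, 0 < μ a → F a = G a) :
    μ.expect F = μ.expect G :=
  le_antisymm (expect_mono fun a ha => (h a ha).le) (expect_mono fun a ha => (h a ha).ge)

lemma expect_const (μ : Dist α) (c : ℝ) : (μ.expect fun _ => c) = c := by
  rw [expect, ← sum_mul, stdSimplex.sum_eq_one, one_mul]

lemma expect_nonneg {μ : Dist α} {F : α → ℝ} (h : ∀ a, 0 < μ a → 0 ≤ F a) : 0 ≤ μ.expect F :=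
  (expect_const μ 0).symm.trans_le (expect_mono h)

lemma expect_le {μ : Dist α} {F : α → ℝ} {c : ℝ} (h : ∀ a, 0 < μ a → F a ≤ c) :
    μ.expect F ≤ c :=
  (expect_mono h).trans_eq (expect_const μ c)

lemma expect_add (μ : Dist α) (F G : α → ℝ) :
    (μ.expect fun a => F a + G a) = μ.expect F + μ.expect G := by
  simp only [expect, mul_add, sum_add_distrib]

lemma expect_sub (μ : Dist α) (F G : α → ℝ) :
    (μ.expect fun a => F a - G a) = μ.expect F - μ.expect G := by
  simp only [expect, mul_sub, sum_sub_distrib]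

lemma expect_const_mul (μ : Dist α) (c : ℝ) (F : α → ℝ) :
    (μ.expect fun a => c * F a) = c * μ.expect F := by
  simp only [expect, mul_sum, mul_left_comm c]

lemma expect_sum {ι : Type*} (μ : Dist α) (s : Finset ι) (F : ι → α → ℝ) :
    (μ.expect fun a => ∑ i ∈ s, F i a) = ∑ i ∈ s, μ.expect (F i) := by
  simp only [expect, mul_sum]
  exact sum_comm

lemma expect_comm (μ : Dist α) (ν : Dist β) (F : α → β → ℝ) :
    (μ.expect fun a => ν.expect (F a)) = ν.expect fun b => μ.expect fun a => F a b := by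
  simp only [expect, mul_sum]
  rw [sum_comm]
  simp only [mul_left_comm]

lemma mul_le_expect {μ : Dist α} {F : α → ℝ} (hF : ∀ a, 0 ≤ F a) (a : α) :
    μ a * F a ≤ μ.expect F :=
  single_le_sum (fun a _ => mul_nonneg (stdSimplex.zero_le μ a) (hF a)) (mem_univ a)

lemma exists_pos_le_of_expect_le {μ : Dist α} {F : α → ℝ} {c : ℝ} (h : μ.expect F ≤ c) :
    ∃ a, 0 < μ a ∧ F a ≤ c := by
  by_contra! hlt
  obtain ⟨a, -, ha⟩ : ∃ a ∈ univ, 0 < μ a :=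
    exists_lt_of_sum_lt (by simp [stdSimplex.sum_eq_one])
  have hsum : ∑ a, μ a * c < ∑ a, μ a * F a := by
    refine sum_lt_sum (fun b _ => ?_) ⟨a, mem_univ a, mul_lt_mul_of_pos_left (hlt a ha) ha⟩
    rcases (stdSimplex.zero_le μ b).eq_or_lt with h0 | h0
    · rw [← h0, zero_mul, zero_mul]
    · exact mul_le_mul_of_nonneg_left (hlt b h0).le h0.le
  exact (hsum.trans_le h).ne (expect_const μ c)

open Classical in
/-- The probability of the event `P`. -/
noncomputable def prob (μ : Dist α) (P : α → Prop) : ℝ := μ.expect fun a => if P a then 1 else 0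

lemma prob_mono {μ : Dist α} {P Q : α → Prop} (h : ∀ a, P a → Q a) : μ.prob P ≤ μ.prob Q :=
  expect_mono fun a _ => by
    by_cases hP : P a
    · rw [if_pos hP, if_pos (h a hP)]
    · rw [if_neg hP]
      positivity

lemma prob_nonneg (μ : Dist α) (P : α → Prop) : 0 ≤ μ.prob P :=
  expect_nonneg fun a _ => by positivity

lemma prob_or_le (μ : Dist α) (P Q : α → Prop) :
    (μ.prob fun a => P a ∨ Q a) ≤ μ.prob P + μ.prob Q := by
  rw [prob, prob, prob, ← expect_add]
  refine expect_mono fun a _ => ?_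
  by_cases hP : P a <;> by_cases hQ : Q a <;> simp [hP, hQ]

lemma prob_exists_le {ι : Type*} (μ : Dist α) (s : Finset ι) (P : ι → α → Prop) :
    (μ.prob fun a => ∃ i ∈ s, P i a) ≤ ∑ i ∈ s, μ.prob (P i) := by
  classical
  simp only [prob]
  rw [← expect_sum]
  refine expect_mono fun a _ => ?_
  have hnonneg : ∀ i ∈ s, (0 : ℝ) ≤ if P i a then 1 else 0 := fun i _ => by positivity
  split_ifs with h
  · obtain ⟨i, hi, hP⟩ := h
    exact (if_pos hP).symm.trans_le (single_le_sum hnonneg hi)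
  · exact sum_nonneg hnonneg

lemma prob_not (μ : Dist α) (P : α → Prop) : (μ.prob fun a => ¬P a) = 1 - μ.prob P := by
  rw [prob, prob, eq_sub_iff_add_eq, ← expect_add]
  refine Eq.trans ?_ (expect_const μ 1)
  exact expect_congr fun a _ => by by_cases hP : P a <;> simp [hP]

lemma prob_mul_expect_lt_le {μ : Dist α} {F : α → ℝ} (hF : ∀ a, 0 ≤ F a) {c : ℝ} (hc : 0 < c) :
    (μ.prob fun a => c * μ.expect F < F a) ≤ 1 / c := by
  rcases (expect_nonneg (μ := μ) fun a _ => hF a).eq_or_lt with h0 | hpos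
  · refine (expect_le fun a ha => ?_).trans (one_div_pos.2 hc).le
    rw [← h0, mul_zero, if_neg (not_lt.2 ?_)]
    exact nonpos_of_mul_nonpos_right ((mul_le_expect hF a).trans h0.ge) ha
  · calc (μ.prob fun a => c * μ.expect F < F a) ≤ μ.expect F / (c * μ.expect F) := by
          rw [le_div_iff₀' (mul_pos hc hpos), prob, ← expect_const_mul μ (c * μ.expect F)]
          refine expect_mono fun a _ => ?_
          split_ifs with h
          · rw [mul_one]
            exact h.le
          · rw [mul_zero]
            exact hF a
      _ = 1 / c := by field_simp

lemma prob_mem (μ : Dist α) (s : Finset α) : (μ.prob fun a => a ∈ s) = ∑ a ∈ s, μ a := by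
  classical
  simp [prob, expect, sum_ite_mem]

/-! ### Channels and products -/

/-- The uniform distribution. -/
noncomputable def uniform (α : Type*) [Fintype α] [Nonempty α] : Dist α := stdSimplex.barycenter

lemma uniform_apply [Nonempty α] (a : α) : uniform α a = (Fintype.card α : ℝ)⁻¹ := rfl

lemma uniform_pos [Nonempty α] (a : α) : 0 < uniform α a :=
  inv_pos.2 (Nat.cast_pos.2 Fintype.card_pos)

lemma expect_uniform [Nonempty α] (F : α → ℝ) :
    (uniform α).expect F = (∑ a, F a) / Fintype.card α := by
  simp only [expect, uniform_apply, inv_mul_eq_div, sum_div]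

/-- The output law of the channel `W` for an input of law `μ`. -/
noncomputable def bind (μ : Dist α) (W : Channel α β) : Dist β :=
  ⟨fun b => μ.expect fun a => W a b,
    fun b => expect_nonneg fun a _ => stdSimplex.zero_le (W a) b, by
      rw [← expect_sum]
      simp only [stdSimplex.sum_eq_one, expect_const]⟩

lemma bind_apply (μ : Dist α) (W : Channel α β) (b : β) :
    μ.bind W b = μ.expect fun a => W a b := rfl

lemma expect_bind (μ : Dist α) (W : Channel α β) (F : β → ℝ) :
    (μ.bind W).expect F = μ.expect fun a => (W a).expect F := by
  simp only [expect, bind_apply, sum_mul, mul_sum, mul_assoc]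
  exact sum_comm

lemma prob_bind (μ : Dist α) (W : Channel α β) (P : β → Prop) :
    (μ.bind W).prob P = μ.expect fun a => (W a).prob P :=
  expect_bind μ W _

lemma bind_assoc (μ : Dist α) (W : Channel α β) (V : Channel β γ) :
    (μ.bind W).bind V = μ.bind fun a => (W a).bind V :=
  stdSimplex.ext <| funext fun c => expect_bind μ W fun b => V b c

lemma bind_apply_pos {μ : Dist α} {W : Channel α β} {a : α} {b : β} (ha : 0 < μ a)
    (hb : 0 < W a b) : 0 < μ.bind W b :=
  (mul_pos ha hb).trans_le (mul_le_expect (fun a => stdSimplex.zero_le (W a) b) a)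

lemma exists_pos_of_bind_apply_pos {μ : Dist α} {W : Channel α β} {b : β} (hb : 0 < μ.bind W b) :
    ∃ a, 0 < μ a ∧ 0 < W a b := by
  by_contra! h
  exact hb.not_ge (expect_le h)

/-- The joint law of the input and the output of the channel `W`. -/
noncomputable def joint (μ : Dist α) (W : Channel α β) : Dist (α × β) :=
  ⟨fun x => μ x.1 * W x.1 x.2,
    fun x => mul_nonneg (stdSimplex.zero_le μ x.1) (stdSimplex.zero_le (W x.1) x.2), by
      simp only [Fintype.sum_prod_type, ← mul_sum, stdSimplex.sum_eq_one, mul_one]⟩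

lemma joint_apply (μ : Dist α) (W : Channel α β) (x : α × β) :
    μ.joint W x = μ x.1 * W x.1 x.2 := rfl

lemma expect_joint (μ : Dist α) (W : Channel α β) (F : α × β → ℝ) :
    (μ.joint W).expect F = μ.expect fun a => (W a).expect fun b => F (a, b) := by
  simp only [expect, joint_apply, Fintype.sum_prod_type, mul_sum, mul_assoc]

lemma exists_eq_joint [Nonempty β] (P : Dist (α × β)) :
    ∃ (μ : Dist α) (W : Channel α β), P = μ.joint W := by
  classical
  have hP := stdSimplex.zero_le P
  let m : α → ℝ := fun a => ∑ b, P (a, b)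
  have hm : ∀ a, 0 ≤ m a := fun a => sum_nonneg fun b _ => hP (a, b)
  let W : Channel α β := fun a =>
    if h : m a = 0 then uniform β
    else ⟨fun b => P (a, b) / m a, fun b => div_nonneg (hP _) (hm a), by
      rw [← sum_div, div_self h]⟩
  refine ⟨⟨m, hm, ?_⟩, W, stdSimplex.ext <| funext fun ⟨a, b⟩ => ?_⟩
  · rw [← Fintype.sum_prod_type', ← stdSimplex.sum_eq_one P]
  · change P (a, b) = m a * W a b
    by_cases h : m a = 0
    · rw [h, zero_mul]
      exact (sum_eq_zero_iff_of_nonneg fun b _ => hP (a, b)).1 h b (mem_univ b)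
    · simp only [W, dif_neg h]
      exact (mul_div_cancel₀ _ h).symm

section Pi

variable {ι : Type*} [Fintype ι] [DecidableEq ι]

/-- The law of a family of independent random variables of laws `μ i`. -/
noncomputable def pi (μ : ι → Dist α) : Dist (ι → α) :=
  ⟨fun x => ∏ i, μ i (x i), fun x => prod_nonneg fun i _ => stdSimplex.zero_le (μ i) (x i), by
    rw [← Fintype.prod_sum]
    simp only [stdSimplex.sum_eq_one, prod_const_one]⟩

lemma pi_apply (μ : ι → Dist α) (x : ι → α) : pi μ x = ∏ i, μ i (x i) := rfl

lemma pi_apply_pos_iff {μ : ι → Dist α} {x : ι → α} : 0 < pi μ x ↔ ∀ i, 0 < μ i (x i) := by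
  refine ⟨fun h i => ?_, fun h => prod_pos fun i _ => h i⟩
  exact (stdSimplex.zero_le (μ i) (x i)).lt_of_ne fun h0 =>
    h.ne' (prod_eq_zero (mem_univ i) h0.symm)

lemma expect_pi_prod (μ : ι → Dist α) (F : ι → α → ℝ) :
    ((pi μ).expect fun x => ∏ i, F i (x i)) = ∏ i, (μ i).expect (F i) := by
  simp only [expect, pi_apply, ← prod_mul_distrib]
  exact (Fintype.prod_sum fun i a => μ i a * F i a).symm

lemma pi_bind (μ : ι → Dist α) (W : Channel α β) :
    ((pi μ).bind fun x => pi fun i => W (x i)) = pi fun i => (μ i).bind W :=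
  stdSimplex.ext <| funext fun y => expect_pi_prod μ fun i a => W a (y i)

-- Exchanging `s` with the coordinate `x i` permutes the pairs `(s, x)` and preserves their weights.
lemma expect_pi_update (μ : ι → Dist α) (i : ι) (F : (ι → α) → ℝ) :
    ((μ i).expect fun s => (pi μ).expect fun x => F (Function.update x i s)) =
      (pi μ).expect F := by
  have hweight (s : α) (x : ι → α) :
      μ i s * pi μ x = μ i (x i) * pi μ (Function.update x i s) := by
    have hrest : ∏ j ∈ univ.erase i, μ j (Function.update x i s j) =
        ∏ j ∈ univ.erase i, μ j (x j) :=
      prod_congr rfl fun j hj => by rw [Function.update_of_ne (ne_of_mem_erase hj)]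
    rw [pi_apply, pi_apply, ← mul_prod_erase univ _ (mem_univ i),
      ← mul_prod_erase univ (fun j => μ j (Function.update x i s j)) (mem_univ i), hrest,
      Function.update_self]
    ring
  have hswap : Function.Involutive fun z : α × (ι → α) => (z.2 i, Function.update z.2 i z.1) :=
    fun z => by simp
  calc ((μ i).expect fun s => (pi μ).expect fun x => F (Function.update x i s))
      = ∑ z : α × (ι → α), μ i (z.2 i) * pi μ (Function.update z.2 i z.1) *
          F (Function.update z.2 i z.1) := by
        simp only [expect, mul_sum, Fintype.sum_prod_type, ← mul_assoc]
        exact sum_congr rfl fun s _ => sum_congr rfl fun x _ => by rw [hweight]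
    _ = ∑ z : α × (ι → α), μ i z.1 * pi μ z.2 * F z.2 :=
        Equiv.sum_comp hswap.toPerm fun z => μ i z.1 * pi μ z.2 * F z.2
    _ = (μ i).expect fun _ => (pi μ).expect F := by
        simp only [expect, mul_sum, Fintype.sum_prod_type, ← mul_assoc]
    _ = (pi μ).expect F := expect_const _ _

lemma expect_pi_eval (μ : ι → Dist α) (i : ι) (F : α → ℝ) :
    ((pi μ).expect fun x => F (x i)) = (μ i).expect F := by
  rw [← expect_pi_update μ i]
  simp only [Function.update_self, expect_const]

lemma expect_pi_eval₂ (μ : ι → Dist α) {i j : ι} (hij : i ≠ j) (F : α → α → ℝ) :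
    ((pi μ).expect fun x => F (x i) (x j)) =
      (μ i).expect fun s => (μ j).expect fun s' => F s s' := by
  rw [← expect_pi_update μ i]
  simp only [Function.update_self, Function.update_of_ne hij.symm, expect_pi_eval]

end Pi

end Dist

namespace Channel

variable {α β γ : Type*} [Fintype β] [Fintype γ]

/-- The channel `W` with the prefix channel `G`. -/
noncomputable def comp (G : Channel α β) (W : Channel β γ) : Channel α γ := fun a => (G a).bind W

end Channel

lemma memoryless_eq_pi {α β : Type*} [Fintype β] (W : Channel α β) (n : ℕ) (x : Fin n → α) :
    memoryless W n x = Dist.pi fun i => W (x i) := rfl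

lemma memoryless_comp {α β γ : Type*} [Fintype β] [Fintype γ] (G : Channel α β) (W : Channel β γ)
    (n : ℕ) : (memoryless G n).comp (memoryless W n) = memoryless (G.comp W) n :=
  funext fun x => Dist.pi_bind (fun i => G (x i)) W

section Information

variable {α β σ : Type*} [Fintype α] [Fintype β] [Fintype σ]

/-- The relative entropy `D(μ ‖ ν)` in nats. It is only meaningful when `μ` is absolutely
continuous with respect to `ν`, because of the junk value `log (x / 0) = 0`. -/
noncomputable def relEntropy (μ ν : Dist α) : ℝ := μ.expect fun a => Real.log (μ a / ν a)

/-- The mutual information, in nats, of the input and the output of the channel `W` for an input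
of law `p`. -/
noncomputable def channelInfo (p : Dist σ) (W : Channel σ β) : ℝ :=
  p.expect fun s => relEntropy (W s) (p.bind W)

lemma mutualInfo_mul (p : Dist σ) (W : Channel σ β) :
    mutualInfo (fun s b => p s * W s b) = channelInfo p W / Real.log 2 := by
  rw [mutualInfo, channelInfo, Dist.expect, sum_div]
  refine sum_congr rfl fun s _ => ?_
  rw [relEntropy, Dist.expect, mul_sum, sum_div, ← mul_sum, stdSimplex.sum_eq_one, mul_one]
  refine sum_congr rfl fun b _ => ?_
  rcases eq_or_ne (p s) 0 with h | h
  · rw [h, zero_mul, zero_mul, zero_mul, zero_div]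
  · rw [mul_div_mul_left _ _ h, Real.logb, mul_assoc, mul_div_assoc, mul_div_assoc]
    rfl

lemma mutualInfo_outputLaw_joint (p : Dist σ) (G : Channel σ α) (W : Channel α β) :
    mutualInfo (outputLaw (p.joint G) W) = channelInfo p (G.comp W) / Real.log 2 := by
  rw [← mutualInfo_mul]
  congr 1 with s b
  simp only [outputLaw, Dist.joint_apply, mul_assoc, ← mul_sum]
  rfl

-- Donsker–Varadhan's variational bound, restricted to normalised test functions.
lemma expect_log_le_relEntropy {μ ν : Dist α} {g : α → ℝ} (hμν : ∀ a, 0 < μ a → 0 < ν a)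
    (hg : ∀ a, 0 < g a) (hg1 : ν.expect g ≤ 1) :
    (μ.expect fun a => Real.log (g a)) ≤ relEntropy μ ν := by
  have hlog : (μ.expect fun a => Real.log (g a) - Real.log (μ a / ν a)) ≤
      μ.expect fun a => ν a * g a / μ a - 1 := by
    refine Dist.expect_mono fun a ha => ?_
    have hν := hμν a ha
    rw [← Real.log_div (hg a).ne' (div_pos ha hν).ne', div_div_eq_mul_div, mul_comm]
    exact Real.log_le_sub_one_of_pos (div_pos (mul_pos hν (hg a)) ha)
  have hmass : (μ.expect fun a => ν a * g a / μ a) ≤ ν.expect g := by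
    refine sum_le_sum fun a _ => ?_
    rcases eq_or_ne (μ a) 0 with h0 | h0
    · rw [h0, zero_mul]
      exact mul_nonneg (stdSimplex.zero_le ν a) (hg a).le
    · rw [mul_div_cancel₀ _ h0]
  rw [Dist.expect_sub, Dist.expect_sub, Dist.expect_const] at hlog
  rw [relEntropy]
  linarith

lemma relEntropy_nonneg {μ ν : Dist α} (hμν : ∀ a, 0 < μ a → 0 < ν a) : 0 ≤ relEntropy μ ν := by
  simpa only [Real.log_one, Dist.expect_const] using
    expect_log_le_relEntropy hμν (fun _ => one_pos) (ν.expect_const 1).le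

lemma relEntropy_joint (p : Dist σ) (W V : Channel σ β) :
    relEntropy (p.joint W) (p.joint V) = p.expect fun s => relEntropy (W s) (V s) := by
  rw [relEntropy, Dist.expect_joint]
  refine Dist.expect_congr fun s hs => ?_
  simp only [Dist.joint_apply, mul_div_mul_left _ _ hs.ne', relEntropy]

lemma channelInfo_nonneg (p : Dist σ) (W : Channel σ β) : 0 ≤ channelInfo p W :=
  Dist.expect_nonneg fun _ hs => relEntropy_nonneg fun _ hb => Dist.bind_apply_pos hs hb

lemma expect_relEntropy_eq_channelInfo_add (p : Dist σ) (W : Channel σ β) {ν : Dist β}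
    (hν : ∀ b, 0 < p.bind W b → 0 < ν b) :
    (p.expect fun s => relEntropy (W s) ν) = channelInfo p W + relEntropy (p.bind W) ν := by
  rw [channelInfo, relEntropy, Dist.expect_bind, ← Dist.expect_add]
  refine Dist.expect_congr fun s hs => ?_
  rw [relEntropy, relEntropy, ← Dist.expect_add]
  refine Dist.expect_congr fun b hb => ?_
  have hpb : 0 < p.bind W b := Dist.bind_apply_pos hs hb
  rw [← Real.log_mul (div_pos hb hpb).ne' (div_pos hpb (hν b hpb)).ne', div_mul_div_cancel₀ hpb.ne']

lemma channelInfo_le_expect_relEntropy (p : Dist σ) (W : Channel σ β) {ν : Dist β}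
    (hν : ∀ b, 0 < p.bind W b → 0 < ν b) :
    channelInfo p W ≤ p.expect fun s => relEntropy (W s) ν := by
  rw [expect_relEntropy_eq_channelInfo_add p W hν]
  exact le_add_of_nonneg_right (relEntropy_nonneg hν)

lemma channelInfo_of_subsingleton [Subsingleton σ] (p : Dist σ) (W : Channel σ β) :
    channelInfo p W = 0 := by
  refine (Dist.expect_congr fun s _ => ?_).trans (p.expect_const 0)
  have hbind : p.bind W = W s := stdSimplex.ext <| funext fun b =>
    (Dist.expect_congr fun s' _ => by rw [Subsingleton.elim s' s]).trans (p.expect_const (W s b))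
  rw [hbind, relEntropy]
  refine (Dist.expect_congr fun b hb => ?_).trans (Dist.expect_const _ 0)
  rw [div_self hb.ne', Real.log_one]

omit [Fintype β] in
lemma card_filter_mem_le_one {κ : Type*} [Fintype κ] [DecidableEq β] {D : κ → Finset β}
    (hD : ∀ i j, i ≠ j → Disjoint (D i) (D j)) (y : β) : #{j | y ∈ D j} ≤ 1 :=
  card_le_one.2 fun i hi j hj => by
    by_contra hij
    exact disjoint_left.1 (hD i j hij) (mem_filter.1 hi).2 (mem_filter.1 hj).2

lemma prob_mul_log_sub_log_two_le [DecidableEq β] (μ : Dist β) (s : Finset β) {N : ℝ}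
    (hN : 1 ≤ N) :
    (μ.prob fun y => y ∈ s) * Real.log N - Real.log 2 ≤
      μ.expect fun y => Real.log ((1 + if y ∈ s then N else 0) / 2) := by
  have hpoint (y : β) : Real.log N * (if y ∈ s then 1 else 0) - Real.log 2 ≤
      Real.log ((1 + if y ∈ s then N else 0) / 2) := by
    rw [Real.log_div (by positivity) two_ne_zero]
    gcongr
    split_ifs
    · simpa only [mul_one] using Real.log_le_log (by linarith) (by linarith)
    · simp
  calc (μ.prob fun y => y ∈ s) * Real.log N - Real.log 2
      = μ.expect fun y => Real.log N * (if y ∈ s then 1 else 0) - Real.log 2 := by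
        rw [Dist.expect_sub, Dist.expect_const_mul, Dist.expect_const, Dist.prob, mul_comm]
        congr!
    _ ≤ _ := Dist.expect_mono fun y _ => hpoint y

lemma fano_inequality {κ : Type*} [Fintype κ] [Nonempty κ] {D : κ → Finset β}
    (hD : ∀ i j, i ≠ j → Disjoint (D i) (D j)) {K : Channel κ β} {ε : ℝ}
    (hK : ∀ j, ((K j).prob fun y => y ∉ D j) ≤ ε) :
    (1 - ε) * Real.log (Fintype.card κ) - Real.log 2 ≤ channelInfo (Dist.uniform κ) K := by
  classical
  set N : ℝ := (Fintype.card κ : ℝ) with hN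
  have hN1 : 1 ≤ N := Nat.one_le_cast.2 Fintype.card_pos
  let p := Dist.uniform κ
  let g : κ × β → ℝ := fun x => (1 + if x.2 ∈ D x.1 then N else 0) / 2
  have hg1 : (p.joint fun _ => p.bind K).expect g ≤ 1 := by
    rw [Dist.expect_joint, Dist.expect_comm]
    refine Dist.expect_le fun y _ => ?_
    have hcount : (#{j | y ∈ D j} : ℝ) ≤ 1 := mod_cast card_filter_mem_le_one hD y
    rw [Dist.expect_uniform, ← hN, div_le_one (by linarith), ← sum_div, sum_add_distrib,
      ← sum_filter, sum_const, sum_const, card_univ, nsmul_eq_mul, nsmul_eq_mul, mul_one, ← hN]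
    nlinarith only [hcount, hN1]
  have hlog (j : κ) :
      (1 - ε) * Real.log N - Real.log 2 ≤ (K j).expect fun y => Real.log (g (j, y)) := by
    have hmem : 1 - ε ≤ (K j).prob fun y => y ∈ D j := by
      linarith only [hK j, (K j).prob_not fun y => y ∈ D j]
    refine le_trans ?_ (prob_mul_log_sub_log_two_le (K j) (D j) hN1)
    gcongr
  calc (1 - ε) * Real.log N - Real.log 2
      ≤ (p.joint K).expect fun x => Real.log (g x) := by
        rw [Dist.expect_joint, ← p.expect_const (_ - _)]
        exact Dist.expect_mono fun j _ => hlog j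
    _ ≤ relEntropy (p.joint K) (p.joint fun _ => p.bind K) :=
        expect_log_le_relEntropy (fun x hx => mul_pos (Dist.uniform_pos _) <|
          Dist.bind_apply_pos (Dist.uniform_pos _) <|
            pos_of_mul_pos_right hx (Dist.uniform_pos _).le) (fun x => by positivity) hg1
    _ = channelInfo p K := relEntropy_joint p K _

end Information

/-- The law of independent random variables of law `p`, indexed by `ι`. -/
noncomputable def Dist.iid {σ : Type*} [Fintype σ] (p : Dist σ) (ι : Type*) [Fintype ι]
    [DecidableEq ι] : Dist (ι → σ) :=
  Dist.pi fun _ => p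

/-! ### Decoding -/

section Test

variable {σ β θ : Type*} [Fintype σ] [Fintype β]

/-- Some channel of the family gives the output `y` a likelihood for the input `s` that exceeds
`Γ` times its likelihood for a random input of law `p`. -/
def PassesTest (p : Dist σ) (W : θ → Channel σ β) (Γ : ℝ) (s : σ) (y : β) : Prop :=
  ∃ t, Γ * p.bind (W t) y < W t s y

/-- The probability that a random input of law `p` and its output under `W` fail the likelihood
ratio test with threshold `Γ`. -/
noncomputable def missProb (p : Dist σ) (W : Channel σ β) (Γ : ℝ) : ℝ :=
  p.expect fun s => (W s).prob fun y => W s y ≤ Γ * p.bind W y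

lemma prob_passesTest_le [Fintype θ] (p : Dist σ) (W : θ → Channel σ β) {Γ : ℝ} (hΓ : 0 < Γ)
    (y : β) : (p.prob fun s => PassesTest p W Γ s y) ≤ Fintype.card θ / Γ := by
  calc (p.prob fun s => PassesTest p W Γ s y)
      ≤ p.prob fun s => ∃ t ∈ univ, Γ * p.bind (W t) y < W t s y :=
        Dist.prob_mono fun s ⟨t, ht⟩ => ⟨t, mem_univ t, ht⟩
    _ ≤ ∑ t, p.prob fun s => Γ * p.bind (W t) y < W t s y := Dist.prob_exists_le p univ _
    _ ≤ ∑ _t : θ, 1 / Γ := sum_le_sum fun t _ =>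
        Dist.prob_mul_expect_lt_le (fun s => stdSimplex.zero_le (W t s) y) hΓ
    _ = Fintype.card θ / Γ := by rw [sum_const, card_univ, nsmul_eq_mul, mul_one_div]

lemma expect_prob_not_passesTest_le (p : Dist σ) (W : θ → Channel σ β) (Γ : ℝ) (t : θ) :
    (p.expect fun s => (W t s).prob fun y => ¬PassesTest p W Γ s y) ≤ missProb p (W t) Γ :=
  Dist.expect_mono fun _ _ => Dist.prob_mono fun _ h => not_lt.1 fun hlt => h ⟨t, hlt⟩

end Test

section UniqueDecoding

variable {σ β κ Λ : Type*} [Fintype β]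

open Classical in
/-- The outputs that pass the test `T` with a word of row `j` of the codebook `f` and with no word
of another row. -/
noncomputable def uniqueDec (T : σ → β → Prop) (f : κ → Λ → σ) (j : κ) : Finset β :=
  {y | (∃ i, T (f j i) y) ∧ ∀ j' ≠ j, ∀ i, ¬T (f j' i) y}

lemma mem_uniqueDec {T : σ → β → Prop} {f : κ → Λ → σ} {j : κ} {y : β} :
    y ∈ uniqueDec T f j ↔ (∃ i, T (f j i) y) ∧ ∀ j' ≠ j, ∀ i, ¬T (f j' i) y := by
  simp only [uniqueDec, mem_filter_univ]

lemma disjoint_uniqueDec (T : σ → β → Prop) (f : κ → Λ → σ) {j j' : κ} (hj : j ≠ j') :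
    Disjoint (uniqueDec T f j) (uniqueDec T f j') :=
  disjoint_left.2 fun y hy hy' => by
    obtain ⟨⟨i, hi⟩, -⟩ := mem_uniqueDec.1 hy
    exact (mem_uniqueDec.1 hy').2 j hj i hi

lemma prob_notMem_uniqueDec_le [Fintype κ] [DecidableEq κ] [Fintype Λ]
    (T : σ → β → Prop) (f : κ → Λ → σ) (j : κ) (i : Λ) (μ : Dist β) :
    (μ.prob fun y => y ∉ uniqueDec T f j) ≤
      (μ.prob fun y => ¬T (f j i) y) +
        ∑ j' ∈ univ.erase j, ∑ i', μ.prob fun y => T (f j' i') y := by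
  calc (μ.prob fun y => y ∉ uniqueDec T f j)
      ≤ μ.prob fun y => ¬T (f j i) y ∨ ∃ j' ∈ univ.erase j, ∃ i' ∈ univ, T (f j' i') y := by
        refine Dist.prob_mono fun y hy => ?_
        by_contra! h
        refine hy (mem_uniqueDec.2 ⟨⟨i, h.1⟩, fun j' hj' i' => ?_⟩)
        exact h.2 j' (mem_erase.2 ⟨hj', mem_univ j'⟩) i' (mem_univ i')
    _ ≤ _ := μ.prob_or_le _ _
    _ ≤ _ := by
        gcongr
        refine (μ.prob_exists_le _ _).trans (sum_le_sum fun j' _ => μ.prob_exists_le _ _)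

end UniqueDecoding

section RandomCoding

variable {σ β κ Λ : Type*} [Fintype σ] [Fintype β] [Fintype κ] [Fintype Λ] [DecidableEq κ]
  [DecidableEq Λ] [Nonempty Λ]

omit [Nonempty Λ] in
lemma expect_iid_iid_eval (p : Dist σ) (j : κ) (i : Λ) (F : σ → ℝ) :
    (((p.iid Λ).iid κ).expect fun f => F (f j i)) = p.expect F :=
  (Dist.expect_pi_eval (fun _ : κ => p.iid Λ) j fun u => F (u i)).trans
    (Dist.expect_pi_eval (fun _ : Λ => p) i F)

omit [Nonempty Λ] in
lemma expect_iid_iid_eval₂ (p : Dist σ) {j j' : κ} (hj : j ≠ j') (i i' : Λ) (F : σ → σ → ℝ) :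
    (((p.iid Λ).iid κ).expect fun f => F (f j i) (f j' i')) =
      p.expect fun s => p.expect (F s) := by
  calc (((p.iid Λ).iid κ).expect fun f => F (f j i) (f j' i'))
      = (p.iid Λ).expect fun u => (p.iid Λ).expect fun u' => F (u i) (u' i') :=
        Dist.expect_pi_eval₂ (fun _ : κ => p.iid Λ) hj fun u u' => F (u i) (u' i')
    _ = p.expect fun s => (p.iid Λ).expect fun u' => F s (u' i') :=
        Dist.expect_pi_eval (fun _ : Λ => p) i fun s => (p.iid Λ).expect fun u' => F s (u' i')
    _ = p.expect fun s => p.expect (F s) := by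
        congr 1 with s
        exact Dist.expect_pi_eval (fun _ : Λ => p) i' (F s)

lemma expect_iid_iid_prob_notMem_uniqueDec_le (p : Dist σ) (W : Channel σ β) {T : σ → β → Prop}
    {δ : ℝ} (hδ : 0 ≤ δ) (hT : ∀ y, (p.prob fun s => T s y) ≤ δ) (j : κ) :
    (((p.iid Λ).iid κ).expect fun f =>
        ((Dist.uniform Λ).bind fun i => W (f j i)).prob fun y => y ∉ uniqueDec T f j) ≤
      (p.expect fun s => (W s).prob fun y => ¬T s y) + Fintype.card κ * Fintype.card Λ * δ := by
  have hconfused {j' : κ} (hj : j ≠ j') (i i' : Λ) :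
      (((p.iid Λ).iid κ).expect fun f => (W (f j i)).prob fun y => T (f j' i') y) ≤ δ := by
    rw [expect_iid_iid_eval₂ p hj i i' fun s s' => (W s).prob fun y => T s' y]
    refine Dist.expect_le fun s _ => ?_
    unfold Dist.prob
    rw [Dist.expect_comm]
    exact Dist.expect_le fun y _ => hT y
  simp only [Dist.prob_bind]
  rw [Dist.expect_comm]
  refine Dist.expect_le fun i _ => ?_
  refine (Dist.expect_mono fun f _ => prob_notMem_uniqueDec_le T f j i (W (f j i))).trans ?_
  simp only [Dist.expect_add, Dist.expect_sum]
  rw [expect_iid_iid_eval p j i fun s => (W s).prob fun y => ¬T s y]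
  gcongr
  calc _ ≤ ∑ _j' ∈ univ.erase j, ∑ _i' : Λ, δ := sum_le_sum fun j' hj' => sum_le_sum fun i' _ =>
        hconfused (ne_of_mem_erase hj').symm i i'
    _ ≤ ∑ _j' : κ, ∑ _i' : Λ, δ := sum_le_sum_of_subset_of_nonneg (erase_subset j univ)
        fun _ _ _ => sum_nonneg fun _ _ => hδ
    _ = Fintype.card κ * Fintype.card Λ * δ := by
        simp only [sum_const, card_univ, nsmul_eq_mul, mul_assoc]

end RandomCoding

/-! ### Resolvability -/

lemma mul_log_add_le {x r : ℝ} (hx : 0 ≤ x) (hr : 0 ≤ r) :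
    x * Real.log (x + r) ≤ x * Real.log (1 + x) + x / (1 + x) * (r - 1) := by
  rcases hx.eq_or_lt with rfl | hpos
  · simp only [zero_mul, zero_div, add_zero, le_refl]
  have hsum : 0 < x + r := add_pos_of_pos_of_nonneg hpos hr
  have hlog := Real.log_le_sub_one_of_pos (div_pos hsum (by positivity : 0 < 1 + x))
  rw [Real.log_div hsum.ne' (by positivity)] at hlog
  calc x * Real.log (x + r) ≤ x * (Real.log (1 + x) + ((x + r) / (1 + x) - 1)) := by
        gcongr
        linarith
    _ = x * Real.log (1 + x) + x / (1 + x) * (r - 1) := by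
        field_simp
        ring

section Resolvability

variable {σ γ Λ : Type*} [Fintype σ] [Fintype γ] [Fintype Λ] [DecidableEq Λ]

-- Conditionally on `u i`, the other summands have mean at most one, so that by concavity the
-- logarithm is on average at most `log (1 + x (u i))`.
lemma expect_iid_mul_log_sum_le (p : Dist σ) {x : σ → ℝ} (hx : ∀ s, 0 ≤ x s)
    (hx1 : Fintype.card Λ * p.expect x ≤ 1) (i : Λ) :
    ((p.iid Λ).expect fun u => x (u i) * Real.log (∑ i', x (u i'))) ≤
      p.expect fun s => x s * Real.log (1 + x s) := by
  let R : (Λ → σ) → ℝ := fun u => ∑ i' ∈ univ.erase i, x (u i')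
  have hR (u : Λ → σ) : 0 ≤ R u := sum_nonneg fun i' _ => hx (u i')
  have hRmean : (p.iid Λ).expect R ≤ 1 := by
    calc (p.iid Λ).expect R = ∑ _i' ∈ univ.erase i, p.expect x := by
          rw [Dist.expect_sum]
          exact sum_congr rfl fun i' _ => Dist.expect_pi_eval (fun _ => p) i' x
      _ ≤ ∑ _i' : Λ, p.expect x := sum_le_sum_of_subset_of_nonneg (erase_subset i univ)
          fun _ _ _ => Dist.expect_nonneg fun s _ => hx s
      _ = Fintype.card Λ * p.expect x := by rw [sum_const, card_univ, nsmul_eq_mul]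
      _ ≤ 1 := hx1
  have hsplit (u : Λ → σ) (s : σ) : ∑ i', x (Function.update u i s i') = x s + R u := by
    rw [← add_sum_erase univ _ (mem_univ i), Function.update_self]
    exact congrArg _ <| sum_congr rfl fun i' hi' => by
      rw [Function.update_of_ne (ne_of_mem_erase hi')]
  unfold Dist.iid
  rw [← Dist.expect_pi_update (fun _ => p) i]
  simp only [Function.update_self, hsplit]
  refine Dist.expect_mono fun s _ => ?_
  refine (Dist.expect_mono fun u _ => mul_log_add_le (hx s) (hR u)).trans ?_
  rw [Dist.expect_add, Dist.expect_const, Dist.expect_const_mul, Dist.expect_sub,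
    Dist.expect_const]
  exact add_le_of_nonpos_right
    (mul_nonpos_of_nonneg_of_nonpos (div_nonneg (hx s) (add_nonneg zero_le_one (hx s)))
      (sub_nonpos.2 hRmean))

/-- A bound on the mean relative entropy between the output law of `V` for a uniformly chosen word
of a random codebook of `L` words and the output law for a random input. -/
noncomputable def resolvBound (p : Dist σ) (V : Channel σ γ) (L : ℝ) : ℝ :=
  p.expect fun s => (V s).expect fun z => Real.log (1 + V s z / (L * p.bind V z))

variable [Nonempty Λ]

lemma expect_iid_mul_log_bind_uniform_le (p : Dist σ) (V : Channel σ γ) (i : Λ) (z : γ) :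
    ((p.iid Λ).expect fun u => V (u i) z * Real.log
        (((Dist.uniform Λ).bind fun i => V (u i)) z / p.bind V z)) ≤
      p.expect fun s => V s z * Real.log (1 + V s z / (Fintype.card Λ * p.bind V z)) := by
  have hV (s : σ) : 0 ≤ V s z := stdSimplex.zero_le (V s) z
  set L : ℝ := (Fintype.card Λ : ℝ)
  have hL : 0 < L := Nat.cast_pos.2 Fintype.card_pos
  rcases (stdSimplex.zero_le (p.bind V) z).eq_or_lt with h0 | hpos
  · simp only [← h0, div_zero, Real.log_zero, mul_zero, Dist.expect_const, add_zero, Real.log_one,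
      le_refl]
  set q : ℝ := L * p.bind V z
  have hq : 0 < q := mul_pos hL hpos
  have hsum (u : Λ → σ) : ((Dist.uniform Λ).bind fun i => V (u i)) z / p.bind V z =
      ∑ i', V (u i') z / q := by
    rw [Dist.bind_apply, Dist.expect_uniform, div_div, sum_div]
  have hscale (s : σ) (r : ℝ) : V s z * r = q * (V s z / q * r) := by field_simp
  simp only [hsum]
  conv_lhs => enter [2, u]; rw [hscale]
  conv_rhs => enter [2, s]; rw [hscale]
  rw [Dist.expect_const_mul, Dist.expect_const_mul]
  gcongr
  refine expect_iid_mul_log_sum_le p (fun s => div_nonneg (hV s) hq.le) ?_ i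
  simp only [div_eq_inv_mul, Dist.expect_const_mul]
  rw [← Dist.bind_apply, mul_left_comm, inv_mul_cancel₀ hq.ne']

lemma expect_iid_relEntropy_bind_uniform_le (p : Dist σ) (V : Channel σ γ) :
    ((p.iid Λ).expect fun u => relEntropy ((Dist.uniform Λ).bind fun i => V (u i)) (p.bind V)) ≤
      resolvBound p V (Fintype.card Λ) := by
  simp only [relEntropy, Dist.expect_bind]
  rw [Dist.expect_comm]
  refine Dist.expect_le fun i _ => ?_
  simp only [resolvBound]
  calc _ = ∑ z, (p.iid Λ).expect fun u => V (u i) z * Real.log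
          (((Dist.uniform Λ).bind fun i => V (u i)) z / p.bind V z) := Dist.expect_sum _ univ _
    _ ≤ ∑ z, p.expect fun s =>
          V s z * Real.log (1 + V s z / (Fintype.card Λ * p.bind V z)) :=
        sum_le_sum fun z _ => expect_iid_mul_log_bind_uniform_le p V i z
    _ = _ := (Dist.expect_sum _ univ _).symm

end Resolvability

/-! ### Existence of good codebooks -/

lemma exists_injective_forall_le_of_sum_le {J : ℕ} {x : Fin (2 * J) → ℝ} (hx : ∀ j, 0 ≤ x j)
    {δ : ℝ} (hsum : ∑ j, x j ≤ 2 * J * δ) :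
    ∃ e : Fin J → Fin (2 * J), Function.Injective e ∧ ∀ j, x (e j) ≤ 2 * δ := by
  let s : Finset (Fin (2 * J)) := {j | x j ≤ 2 * δ}
  have hs : J ≤ #s := by
    by_contra! hlt
    have hcompl : J < #sᶜ := by
      rw [card_compl, Fintype.card_fin]
      lia
    have hbad : ∑ _j ∈ sᶜ, 2 * δ < ∑ j ∈ sᶜ, x j :=
      sum_lt_sum_of_nonempty (card_pos.1 (by lia)) fun j hj => by
        simpa only [s, mem_compl, mem_filter_univ, not_le] using hj
    have hle : ∑ j ∈ sᶜ, x j ≤ ∑ j, x j :=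
      sum_le_sum_of_subset_of_nonneg (subset_univ _) fun j _ _ => hx j
    rw [sum_const, nsmul_eq_mul] at hbad
    have hδ : 0 ≤ δ := by
      have hJ0 : (0 : ℝ) < 2 * J := mod_cast (by lia : 0 < 2 * J)
      exact nonneg_of_mul_nonneg_right ((sum_nonneg fun j _ => hx j).trans hsum) hJ0
    have hJ : J * (2 * δ) ≤ #sᶜ * (2 * δ) := by gcongr
    linarith
  refine ⟨s.orderEmbOfCardLe hs, (s.orderEmbOfCardLe hs).injective, fun j => ?_⟩
  exact (mem_filter.1 (s.orderEmbOfCardLe_mem hs j)).2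

section Codebook

variable {σ β γ θ κ Λ : Type*} [Fintype σ] [Fintype β] [Fintype γ] [Fintype θ] [Fintype Λ]
  [Nonempty Λ]

/-- The cost of the row `j` of the codebook `f`, whose word is chosen uniformly: the sum over the
compound channel of the decoding error and of the relative entropy that bounds the leakage. -/
noncomputable def rowCost (p : Dist σ) (W : θ → Channel σ β) (V : θ → Channel σ γ) (Γ : ℝ)
    (f : κ → Λ → σ) (j : κ) : ℝ :=
  ∑ t, ((((Dist.uniform Λ).bind fun i => W t (f j i)).prob fun y =>
      y ∉ uniqueDec (PassesTest p W Γ) f j) +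
    relEntropy ((Dist.uniform Λ).bind fun i => V t (f j i)) (p.bind (V t)))

lemma expect_rowCost_le [Fintype κ] [DecidableEq κ] [DecidableEq Λ] (p : Dist σ)
    (W : θ → Channel σ β) (V : θ → Channel σ γ) {Γ : ℝ} (hΓ : 0 < Γ) (j : κ) :
    (((p.iid Λ).iid κ).expect fun f => rowCost p W V Γ f j) ≤
      ∑ t, (missProb p (W t) Γ +
        Fintype.card κ * Fintype.card Λ * (Fintype.card θ / Γ) +
          resolvBound p (V t) (Fintype.card Λ)) := by
  simp only [rowCost, Dist.expect_sum, Dist.expect_add]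
  gcongr with t
  · refine (expect_iid_iid_prob_notMem_uniqueDec_le p (W t) (by positivity)
      (prob_passesTest_le p W hΓ) j).trans ?_
    gcongr
    exact expect_prob_not_passesTest_le p W Γ t
  · exact (Dist.expect_pi_eval (fun _ : κ => p.iid Λ) j fun u =>
      relEntropy ((Dist.uniform Λ).bind fun i => V t (u i)) (p.bind (V t))).trans_le
        (expect_iid_relEntropy_bind_uniform_le p (V t))

lemma relEntropy_row_nonneg {p : Dist σ} (V : Channel σ γ) {u : Λ → σ} (hu : ∀ i, 0 < p (u i)) :
    0 ≤ relEntropy ((Dist.uniform Λ).bind fun i => V (u i)) (p.bind V) :=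
  relEntropy_nonneg fun z hz => by
    obtain ⟨i, -, hi⟩ := Dist.exists_pos_of_bind_apply_pos hz
    exact Dist.bind_apply_pos (hu i) hi

lemma exists_codebook {J L : ℕ} [NeZero J] [NeZero L] (p : Dist σ) (W : θ → Channel σ β)
    (V : θ → Channel σ γ) {Γ : ℝ} (hΓ : 0 < Γ) {δ : ℝ}
    (hδ : ∑ t, (missProb p (W t) Γ + 2 * J * L * (Fintype.card θ / Γ) + resolvBound p (V t) L) ≤
      δ) :
    ∃ (u : Fin J → Fin L → σ) (D : Fin J → Finset β), (∀ i j, i ≠ j → Disjoint (D i) (D j)) ∧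
      ∀ t, (∀ j, (((Dist.uniform (Fin L)).bind fun l => W t (u j l)).prob fun y => y ∉ D j) ≤
          2 * δ) ∧
        channelInfo (Dist.uniform (Fin J))
          (fun j => (Dist.uniform (Fin L)).bind fun l => V t (u j l)) ≤ 2 * δ := by
  have hmean : (((p.iid (Fin L)).iid (Fin (2 * J))).expect fun f =>
      ∑ j, rowCost p W V Γ f j) ≤ 2 * J * δ := by
    rw [Dist.expect_sum]
    refine (sum_le_sum fun j _ => expect_rowCost_le p W V hΓ j).trans ?_
    simp only [Fintype.card_fin, sum_const, card_univ, nsmul_eq_mul, Nat.cast_mul, Nat.cast_ofNat]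
    gcongr
  obtain ⟨f, hfpos, hf⟩ := Dist.exists_pos_le_of_expect_le hmean
  have hword (j : Fin (2 * J)) (l : Fin L) : 0 < p (f j l) :=
    Dist.pi_apply_pos_iff.1 (Dist.pi_apply_pos_iff.1 hfpos j) l
  have hD (t : θ) (j : Fin (2 * J)) := relEntropy_row_nonneg (V t) (hword j)
  have hrow (j : Fin (2 * J)) : 0 ≤ rowCost p W V Γ f j :=
    sum_nonneg fun t _ => add_nonneg (Dist.prob_nonneg _ _) (hD t j)
  obtain ⟨e, he, hle⟩ := exists_injective_forall_le_of_sum_le hrow hf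
  have hterm (t : θ) (j : Fin J) := (single_le_sum (fun t _ =>
    add_nonneg (Dist.prob_nonneg _ _) (hD t (e j))) (mem_univ t)).trans (hle j)
  refine ⟨fun j => f (e j), fun j => uniqueDec (PassesTest p W Γ) f (e j),
    fun i j hij => disjoint_uniqueDec _ f (he.ne hij), fun t => ⟨fun j => ?_, ?_⟩⟩
  · exact (le_add_of_nonneg_right (hD t (e j))).trans (hterm t j)
  · refine (channelInfo_le_expect_relEntropy _ _ (ν := p.bind (V t)) fun z hz => ?_).trans
      (Dist.expect_le fun j _ => (le_add_of_nonneg_left (Dist.prob_nonneg _ _)).trans (hterm t j))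
    obtain ⟨j, -, hj⟩ := Dist.exists_pos_of_bind_apply_pos hz
    obtain ⟨l, -, hl⟩ := Dist.exists_pos_of_bind_apply_pos hj
    exact Dist.bind_apply_pos (hword (e j) l) hl

end Codebook

/-! ### Error exponents -/

lemma Dist.exists_expect_exp_lt_one {α : Type*} [Fintype α] {μ : Dist α} {F : α → ℝ}
    (hF : μ.expect F < 0) :
    ∃ s : ℝ, 0 < s ∧ s ≤ 1 ∧ (μ.expect fun a => Real.exp (s * F a)) < 1 := by
  have hderiv : HasDerivAt (fun s : ℝ => μ.expect fun a => Real.exp (s * F a)) (μ.expect F) 0 := by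
    refine HasDerivAt.fun_sum fun a _ => ?_
    simpa using (((hasDerivAt_id (0 : ℝ)).mul_const (F a)).exp).const_mul (μ a)
  have hslope := ((hasDerivAt_iff_tendsto_slope.1 hderiv).mono_left
    (nhdsWithin_mono 0 fun s (hs : s ∈ Set.Ioi 0) => (Set.mem_Ioi.1 hs).ne')).eventually_lt_const hF
  obtain ⟨s, hs, hs0, hs1⟩ := (hslope.and (Ioc_mem_nhdsGT one_pos)).exists
  refine ⟨s, hs0, hs1, ?_⟩
  simp only [slope_def_field, zero_mul, Real.exp_zero, Dist.expect_const, sub_zero] at hs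
  rwa [div_lt_iff₀ hs0, zero_mul, sub_neg] at hs

lemma log_one_add_le_rpow_div {x s : ℝ} (hx : 0 ≤ x) (hs : 0 < s) (hs1 : s ≤ 1) :
    Real.log (1 + x) ≤ x ^ s / s := by
  have hpow : (1 + x) ^ s ≤ 1 + x ^ s := by
    simpa only [Real.one_rpow] using Real.rpow_add_le_add_rpow zero_le_one hx hs.le hs1
  rw [le_div_iff₀ hs]
  calc Real.log (1 + x) * s = Real.log ((1 + x) ^ s) := by
        rw [Real.log_rpow (by positivity), mul_comm]
    _ ≤ Real.log (1 + x ^ s) := Real.log_le_log (by positivity) hpow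
    _ ≤ 1 + x ^ s - 1 := Real.log_le_sub_one_of_pos (by positivity)
    _ = x ^ s := by ring

section Exponents

variable {σ β : Type*} [Fintype σ] [Fintype β]

/-- The information density of the input `s` and the output `y`, whose mean is the mutual
information. -/
noncomputable def infoDensity (p : Dist σ) (W : Channel σ β) (s : σ) (y : β) : ℝ :=
  Real.log (W s y / p.bind W y)

lemma expect_infoDensity (p : Dist σ) (W : Channel σ β) :
    (p.joint W).expect (fun a => infoDensity p W a.1 a.2) = channelInfo p W :=
  Dist.expect_joint p W _

lemma iid_bind_memoryless (p : Dist σ) (W : Channel σ β) (n : ℕ) :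
    (p.iid (Fin n)).bind (memoryless W n) = (p.bind W).iid (Fin n) :=
  Dist.pi_bind (fun _ => p) W

lemma infoDensity_memoryless {p : Dist σ} {W : Channel σ β} {n : ℕ} {x : Fin n → σ}
    {y : Fin n → β} (hx : 0 < p.iid (Fin n) x) (hy : 0 < memoryless W n x y) :
    infoDensity (p.iid (Fin n)) (memoryless W n) x y = ∑ i, infoDensity p W (x i) (y i) := by
  have hx' (i : Fin n) : 0 < p (x i) := Dist.pi_apply_pos_iff.1 hx i
  have hy' (i : Fin n) : 0 < W (x i) (y i) := Dist.pi_apply_pos_iff.1 hy i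
  have hprod : memoryless W n x y / (p.iid (Fin n)).bind (memoryless W n) y =
      ∏ i, W (x i) (y i) / p.bind W (y i) := by
    rw [iid_bind_memoryless, prod_div_distrib]
    rfl
  rw [infoDensity, hprod, Real.log_prod fun i _ =>
    (div_pos (hy' i) (Dist.bind_apply_pos (hx' i) (hy' i))).ne']
  rfl

lemma expect_iid_memoryless_le_pow {p : Dist σ} {W : Channel σ β} {n : ℕ}
    {F : (Fin n → σ) → (Fin n → β) → ℝ} {K s : ℝ} {f : σ → β → ℝ}
    (hF : ∀ x y, 0 < p.iid (Fin n) x → 0 < memoryless W n x y →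
      F x y ≤ K * Real.exp (s * ∑ i, f (x i) (y i))) :
    ((p.iid (Fin n)).expect fun x => (memoryless W n x).expect (F x)) ≤
      K * ((p.joint W).expect fun a => Real.exp (s * f a.1 a.2)) ^ n := by
  calc ((p.iid (Fin n)).expect fun x => (memoryless W n x).expect (F x))
      ≤ (p.iid (Fin n)).expect fun x => (memoryless W n x).expect fun y =>
          K * ∏ i, Real.exp (s * f (x i) (y i)) :=
        Dist.expect_mono fun x hx => Dist.expect_mono fun y hy => by
          rw [← Real.exp_sum, ← mul_sum]
          exact hF x y hx hy
    _ = K * ((p.iid (Fin n)).expect fun x =>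
          ∏ i, (W (x i)).expect fun y => Real.exp (s * f (x i) y)) := by
        simp only [Dist.expect_const_mul, memoryless_eq_pi]
        congr 2 with x
        exact Dist.expect_pi_prod (fun i => W (x i)) fun i y => Real.exp (s * f (x i) y)
    _ = K * ((p.joint W).expect fun a => Real.exp (s * f a.1 a.2)) ^ n := by
        rw [Dist.iid, Dist.expect_pi_prod (fun _ => p) fun _ a =>
          (W a).expect fun y => Real.exp (s * f a y), prod_const, card_univ, Fintype.card_fin,
          Dist.expect_joint]

lemma tendsto_missProb {p : Dist σ} {W : Channel σ β} {r : ℝ} (hr : r < channelInfo p W) :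
    Filter.Tendsto (fun n : ℕ => missProb (p.iid (Fin n)) (memoryless W n) (Real.exp (n * r)))
      Filter.atTop (nhds 0) := by
  obtain ⟨s, hs, -, hlt⟩ := Dist.exists_expect_exp_lt_one (μ := p.joint W)
    (F := fun a => r - infoDensity p W a.1 a.2) (by
      rw [Dist.expect_sub, Dist.expect_const, expect_infoDensity]
      exact sub_neg.2 hr)
  have hρ : 0 ≤ (p.joint W).expect fun a => Real.exp (s * (r - infoDensity p W a.1 a.2)) :=
    Dist.expect_nonneg fun a _ => (Real.exp_pos _).le
  refine squeeze_zero (fun n => Dist.expect_nonneg fun x _ => Dist.prob_nonneg _ _) (fun n => ?_)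
    (tendsto_pow_atTop_nhds_zero_of_lt_one hρ hlt)
  refine (expect_iid_memoryless_le_pow (K := 1) (s := s)
    (f := fun a y => r - infoDensity p W a y) fun x y hx hy => ?_).trans_eq (one_mul _)
  split_ifs with hmiss
  · have hdensity : infoDensity (p.iid (Fin n)) (memoryless W n) x y ≤ n * r := by
      have hq := Dist.bind_apply_pos hx hy
      rwa [infoDensity, Real.log_le_iff_le_exp (div_pos hy hq), div_le_iff₀ hq]
    rw [infoDensity_memoryless hx hy] at hdensity
    rw [one_mul, sum_sub_distrib, sum_const, card_univ, Fintype.card_fin, nsmul_eq_mul,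
      Real.one_le_exp_iff]
    exact mul_nonneg hs.le (sub_nonneg.2 hdensity)
  · positivity

lemma log_one_add_div_le {p : Dist σ} {V : Channel σ β} {n : ℕ} {x : Fin n → σ}
    {z : Fin n → β} (hx : 0 < p.iid (Fin n) x) (hz : 0 < memoryless V n x z) {r s L : ℝ}
    (hs : 0 < s) (hs1 : s ≤ 1) (hL : Real.exp (n * r) ≤ L) :
    Real.log (1 + memoryless V n x z / (L * (p.iid (Fin n)).bind (memoryless V n) z)) ≤
      s⁻¹ * Real.exp (s * ∑ i, (infoDensity p V (x i) (z i) - r)) := by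
  have hLpos : 0 < L := (Real.exp_pos _).trans_le hL
  have hq := Dist.bind_apply_pos hx hz
  set ratio := memoryless V n x z / (L * (p.iid (Fin n)).bind (memoryless V n) z)
  have hratio : 0 < ratio := div_pos hz (mul_pos hLpos hq)
  have hlog : Real.log ratio = infoDensity (p.iid (Fin n)) (memoryless V n) x z - Real.log L := by
    rw [infoDensity, ← Real.log_div (div_pos hz hq).ne' hLpos.ne', div_div, mul_comm _ L]
  calc Real.log (1 + ratio) ≤ ratio ^ s / s := log_one_add_le_rpow_div hratio.le hs hs1
    _ = s⁻¹ * Real.exp (s * Real.log ratio) := by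
        rw [Real.rpow_def_of_pos hratio, div_eq_inv_mul, mul_comm s (Real.log _)]
    _ ≤ s⁻¹ * Real.exp (s * (infoDensity (p.iid (Fin n)) (memoryless V n) x z - n * r)) := by
        rw [hlog]
        gcongr
        exact (Real.le_log_iff_exp_le hLpos).2 hL
    _ = s⁻¹ * Real.exp (s * ∑ i, (infoDensity p V (x i) (z i) - r)) := by
        rw [infoDensity_memoryless hx hz, sum_sub_distrib, sum_const, card_univ, Fintype.card_fin,
          nsmul_eq_mul]

lemma tendsto_resolvBound {p : Dist σ} {V : Channel σ β} {r : ℝ} (hr : channelInfo p V < r)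
    {L : ℕ → ℝ} (hL : ∀ n : ℕ, Real.exp (n * r) ≤ L n) :
    Filter.Tendsto (fun n : ℕ => resolvBound (p.iid (Fin n)) (memoryless V n) (L n))
      Filter.atTop (nhds 0) := by
  obtain ⟨s, hs, hs1, hlt⟩ := Dist.exists_expect_exp_lt_one (μ := p.joint V)
    (F := fun a => infoDensity p V a.1 a.2 - r) (by
      rw [Dist.expect_sub, Dist.expect_const, expect_infoDensity]
      exact sub_neg.2 hr)
  have hρ : 0 ≤ (p.joint V).expect fun a => Real.exp (s * (infoDensity p V a.1 a.2 - r)) :=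
    Dist.expect_nonneg fun a _ => (Real.exp_pos _).le
  have hgeom := (tendsto_pow_atTop_nhds_zero_of_lt_one hρ hlt).const_mul s⁻¹
  rw [mul_zero] at hgeom
  refine squeeze_zero (fun n => Dist.expect_nonneg fun x hx => Dist.expect_nonneg fun z hz => ?_)
    (fun n => expect_iid_memoryless_le_pow (f := fun a y => infoDensity p V a y - r)
      fun x z hx hz => log_one_add_div_le hx hz hs hs1 (hL n)) hgeom
  have hLpos : 0 < L n := (Real.exp_pos _).trans_le (hL n)
  exact Real.log_nonneg (le_add_of_nonneg_right
    (div_pos hz (mul_pos hLpos (Dist.bind_apply_pos hx hz))).le)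

end Exponents

/-! ### Achievability of rate gaps -/

section Codes

variable {θ A B C : Type*} [Fintype A] [Fintype B] [Fintype C] {n J : ℕ}

/-- The code `c` has error probability at most `ε` for every message and leaks at most `ε` bits, for
every state of the compound channel. -/
def Code.IsGood (c : Code A B n J) (W : θ → Channel A B) (V : θ → Channel A C) (ε : ℝ) : Prop :=
  (∀ t j, ((c.enc.comp (memoryless (W t) n) j).prob fun y => y ∉ c.dec j) ≤ ε) ∧
    ∀ t, mutualInfo (c.leakLaw (V t)) ≤ ε

lemma Code.IsGood.mono {c : Code A B n J} {W : θ → Channel A B} {V : θ → Channel A C} {ε ε' : ℝ}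
    (hc : c.IsGood W V ε) (h : ε ≤ ε') : c.IsGood W V ε' :=
  ⟨fun t j => (hc.1 t j).trans h, fun t => (hc.2 t).trans h⟩

omit [Fintype B] in
lemma Code.mutualInfo_leakLaw [NeZero J] (c : Code A B n J) (V : Channel A C) :
    mutualInfo (c.leakLaw V) =
      channelInfo (Dist.uniform (Fin J)) (c.enc.comp (memoryless V n)) / Real.log 2 := by
  rw [← mutualInfo_mul]
  congr 1 with j z
  rw [Dist.uniform_apply, Fintype.card_fin, ← one_div]
  rfl

lemma exists_isGood_one [Nonempty A] (W : θ → Channel A B) (V : θ → Channel A C) (n : ℕ) {ε : ℝ}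
    (hε : 0 ≤ ε) : ∃ c : Code A B n 1, c.IsGood W V ε := by
  refine ⟨⟨fun _ => Dist.uniform _, fun _ => univ,
    fun i j hij => (hij (Subsingleton.elim i j)).elim⟩,
    fun t j => Dist.expect_le fun y _ => ?_, fun t => ?_⟩
  · simpa using hε
  · rwa [Code.mutualInfo_leakLaw, channelInfo_of_subsingleton, zero_div]

lemma bind_memoryless_comp {κ Λ υ β : Type*} [Fintype Λ] [Fintype β] (μ : Dist Λ)
    (u : κ → Λ → Fin n → υ) (G : Channel υ A) (W : Channel A β) :
    Channel.comp (fun j => μ.bind fun l => memoryless G n (u j l)) (memoryless W n) =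
      fun j => μ.bind fun l => memoryless (G.comp W) n (u j l) := by
  funext j
  rw [← memoryless_comp]
  exact Dist.bind_assoc _ _ _

lemma exists_isGood_of_bound [Fintype θ] [NeZero J] {L : ℕ} [NeZero L] {υ : Type*} [Fintype υ]
    (p : Dist υ) (G : Channel υ A) (W : θ → Channel A B) (V : θ → Channel A C) {Γ : ℝ} (hΓ : 0 < Γ)
    {δ : ℝ} (hδ : ∑ t, (missProb (p.iid (Fin n)) (memoryless (G.comp (W t)) n) Γ +
        2 * J * L * (Fintype.card θ / Γ) +
        resolvBound (p.iid (Fin n)) (memoryless (G.comp (V t)) n) L) ≤ δ) :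
    ∃ c : Code A B n J, c.IsGood W V (2 * δ / Real.log 2) := by
  obtain ⟨u, D, hD, hgood⟩ := exists_codebook (p.iid (Fin n))
    (fun t => memoryless (G.comp (W t)) n) (fun t => memoryless (G.comp (V t)) n) hΓ hδ
  refine ⟨⟨fun j => (Dist.uniform (Fin L)).bind fun l => memoryless G n (u j l), D, hD⟩,
    fun t j => ?_, fun t => ?_⟩
  · have herr := (hgood t).1 j
    rw [bind_memoryless_comp]
    exact herr.trans (le_div_self ((Dist.prob_nonneg _ _).trans herr) (Real.log_pos one_lt_two)
      (Real.log_two_lt_d9.le.trans (by norm_num)))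
  · rw [Code.mutualInfo_leakLaw, bind_memoryless_comp]
    gcongr
    exact (hgood t).2

end Codes

lemma ceil_exp_le {x : ℝ} (hx : 0 ≤ x) : (⌈Real.exp x⌉₊ : ℝ) ≤ 2 * Real.exp x := by
  linarith [Real.one_le_exp hx, Nat.ceil_lt_add_one (Real.exp_pos x).le]

lemma tendsto_ceil_exp_mul_ceil_exp_div {r s γ : ℝ} (hr : 0 ≤ r) (hs : 0 ≤ s) (h : r + s < γ) :
    Filter.Tendsto (fun n : ℕ =>
        (⌈Real.exp (n * r)⌉₊ : ℝ) * ⌈Real.exp (n * s)⌉₊ / Real.exp (n * γ))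
      Filter.atTop (nhds 0) := by
  have hgeom := (tendsto_pow_atTop_nhds_zero_of_lt_one (Real.exp_pos (r + s - γ)).le
    (Real.exp_lt_one_iff.2 (sub_neg.2 h))).const_mul 4
  rw [mul_zero] at hgeom
  refine squeeze_zero (fun n => by positivity) (fun n => ?_) hgeom
  rw [div_le_iff₀ (Real.exp_pos _), ← Real.exp_nat_mul]
  calc (⌈Real.exp (n * r)⌉₊ : ℝ) * ⌈Real.exp (n * s)⌉₊
      ≤ 2 * Real.exp (n * r) * (2 * Real.exp (n * s)) := by
        gcongr <;> exact ceil_exp_le (by positivity)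
    _ = 4 * Real.exp (n * (r + s - γ)) * Real.exp (n * γ) := by
        rw [mul_assoc 4, ← Real.exp_add, mul_mul_mul_comm, ← Real.exp_add]
        ring_nf

section Achievability

variable {θ A B C υ : Type*} [Fintype A] [Fintype B] [Fintype C] [Fintype υ]

lemma eventually_exists_isGood [Finite θ] [Nonempty θ] (p : Dist υ) (G : Channel υ A)
    (W : θ → Channel A B) (V : θ → Channel A C) {r s γ : ℝ} (hr : 0 ≤ r) (hrs : r + s < γ)
    (hW : ∀ t, γ < channelInfo p (G.comp (W t))) (hV : ∀ t, channelInfo p (G.comp (V t)) < s)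
    {ε : ℝ} (hε : 0 < ε) :
    ∀ᶠ n : ℕ in Filter.atTop, ∃ c : Code A B n ⌈Real.exp (n * r)⌉₊, c.IsGood W V ε := by
  have := Fintype.ofFinite θ
  have hs : 0 ≤ s := (channelInfo_nonneg p _).trans (hV (Classical.arbitrary θ)).le
  have hbound : Filter.Tendsto (fun n : ℕ => ∑ t,
      (missProb (p.iid (Fin n)) (memoryless (G.comp (W t)) n) (Real.exp (n * γ)) +
        2 * ⌈Real.exp (n * r)⌉₊ * ⌈Real.exp (n * s)⌉₊ * (Fintype.card θ / Real.exp (n * γ)) +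
        resolvBound (p.iid (Fin n)) (memoryless (G.comp (V t)) n) ⌈Real.exp (n * s)⌉₊))
      Filter.atTop (nhds 0) := by
    have hconfused := (tendsto_ceil_exp_mul_ceil_exp_div hr hs hrs).const_mul
      (2 * (Fintype.card θ : ℝ))
    have hterm (t : θ) := ((tendsto_missProb (hW t)).add hconfused).add
      (tendsto_resolvBound (hV t) fun n => Nat.le_ceil (Real.exp (n * s)))
    convert tendsto_finsetSum univ fun t _ => hterm t using 2
    · refine sum_congr rfl fun t _ => ?_
      ring
    · simp only [mul_zero, add_zero, sum_const_zero]
  have hlog : 0 < Real.log 2 := Real.log_pos one_lt_two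
  filter_upwards [hbound.eventually_le_const (half_pos (mul_pos hε hlog))]
    with n hn
  have : NeZero ⌈Real.exp (n * r)⌉₊ := ⟨(Nat.ceil_pos.2 (Real.exp_pos _)).ne'⟩
  have : NeZero ⌈Real.exp (n * s)⌉₊ := ⟨(Nat.ceil_pos.2 (Real.exp_pos _)).ne'⟩
  obtain ⟨c, hc⟩ := exists_isGood_of_bound p G W V (Real.exp_pos (n * γ)) hn
  exact ⟨c, hc.mono (by
    rw [mul_div_cancel₀ _ two_ne_zero, mul_div_cancel_right₀ _ hlog.ne'])⟩

/-- Codes of rate at least `R - ε` with error and leakage at most `ε` exist for every `ε > 0` and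
all large block lengths. This is achievability of `R` without a choice of one sequence of codes. -/
def EventuallyAchievable (W : θ → Channel A B) (V : θ → Channel A C) (R : ℝ) : Prop :=
  ∀ ε : ℝ, 0 < ε → ∀ᶠ n : ℕ in Filter.atTop, ∃ J : ℕ, 0 < J ∧ ∃ c : Code A B n J,
    c.IsGood W V ε ∧ n * (R - ε) ≤ Real.logb 2 J

lemma le_logb_ceil_exp (x : ℝ) : x ≤ Real.logb 2 ⌈Real.exp (x * Real.log 2)⌉₊ := by
  rw [Real.logb, le_div_iff₀ (Real.log_pos one_lt_two), Real.le_log_iff_exp_le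
    (Nat.cast_pos.2 (Nat.ceil_pos.2 (Real.exp_pos _)))]
  exact Nat.le_ceil _

theorem eventuallyAchievable_rateGap [Finite θ] [Nonempty θ] [Nonempty A] (W : θ → Channel A B)
    (V : θ → Channel A C) (P : Dist (υ × A)) : EventuallyAchievable W V (rateGap W V P) := by
  intro ε hε
  rcases le_or_gt (rateGap W V P - ε) 0 with hR | hR
  · refine .of_forall fun n => ⟨1, one_pos, ?_⟩
    obtain ⟨c, hc⟩ := exists_isGood_one W V n hε.le
    refine ⟨c, hc, ?_⟩
    simpa using mul_nonpos_of_nonneg_of_nonpos n.cast_nonneg hR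
  obtain ⟨p, G, rfl⟩ := Dist.exists_eq_joint P
  have hlog : 0 < Real.log 2 := Real.log_pos one_lt_two
  let IY := ⨅ t, mutualInfo (outputLaw (p.joint G) (W t))
  let IZ := ⨆ t, mutualInfo (outputLaw (p.joint G) (V t))
  have hIY (t : θ) : IY * Real.log 2 ≤ channelInfo p (G.comp (W t)) := by
    rw [← le_div_iff₀ hlog, ← mutualInfo_outputLaw_joint]
    exact ciInf_le (Set.finite_range _).bddBelow t
  have hIZ (t : θ) : channelInfo p (G.comp (V t)) ≤ IZ * Real.log 2 := by
    rw [← div_le_iff₀ hlog, ← mutualInfo_outputLaw_joint]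
    exact le_ciSup (f := fun t => mutualInfo (outputLaw (p.joint G) (V t)))
      (Set.finite_range _).bddAbove t
  have hslack : 0 < ε * Real.log 2 := mul_pos hε hlog
  have hgap : rateGap W V (p.joint G) * Real.log 2 = IY * Real.log 2 - IZ * Real.log 2 :=
    sub_mul _ _ _
  filter_upwards [eventually_exists_isGood p G W V (r := (rateGap W V (p.joint G) - ε) * Real.log 2)
    (s := IZ * Real.log 2 + ε * Real.log 2 / 4) (γ := IY * Real.log 2 - ε * Real.log 2 / 4)
    (mul_nonneg hR.le hlog.le) (by linarith) (fun t => by linarith [hIY t])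
    (fun t => by linarith [hIZ t]) hε] with n ⟨c, hc⟩
  refine ⟨_, Nat.ceil_pos.2 (Real.exp_pos _), c, hc, ?_⟩
  rw [← mul_assoc]
  exact le_logb_ceil_exp _

end Achievability

/-! ### Codes for blocks -/

section Split

variable {α α' β β' γ γ' σ : Type*} [Fintype α'] [Fintype β'] [Fintype γ'] [Fintype α] [Fintype β]
  [Fintype γ]

/-- The law on `γ` of independent variables of laws `μ` and `ν`, which `E` joins to an element
of `γ`. -/
noncomputable def Dist.prodVia (E : γ ≃ α × β) (μ : Dist α) (ν : Dist β) : Dist γ :=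
  ⟨fun c => μ (E c).1 * ν (E c).2,
    fun c => mul_nonneg (stdSimplex.zero_le μ _) (stdSimplex.zero_le ν _), by
      rw [E.sum_comp fun a => μ a.1 * ν a.2]
      exact stdSimplex.sum_eq_one (μ.joint fun _ => ν)⟩

lemma Dist.prodVia_apply (E : γ ≃ α × β) (μ : Dist α) (ν : Dist β) (c : γ) :
    Dist.prodVia E μ ν c = μ (E c).1 * ν (E c).2 := rfl

lemma Dist.expect_prodVia (E : γ ≃ α × β) (μ : Dist α) (ν : Dist β) (F : α × β → ℝ) :
    ((Dist.prodVia E μ ν).expect fun c => F (E c)) = μ.expect fun a => ν.expect fun b => F (a, b) :=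
  (E.sum_comp fun a => μ a.1 * ν a.2 * F a).trans (Dist.expect_joint μ (fun _ => ν) F)

lemma Dist.prob_prodVia (E : γ ≃ α × β) (μ : Dist α) (ν : Dist β) (P : α → Prop) :
    ((Dist.prodVia E μ ν).prob fun c => P (E c).1) = μ.prob P := by
  classical
  exact (Dist.expect_prodVia E μ ν fun a => if P a.1 then 1 else 0).trans
    (Dist.expect_congr fun a _ => Dist.expect_const ν (if P a then 1 else 0))

lemma Dist.prodVia_bind (E : γ ≃ α × β) (E' : γ' ≃ α' × β') (μ : Dist α) (ν : Dist β)
    (K : Channel α α') (K' : Channel β β') :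
    ((Dist.prodVia E μ ν).bind fun c => Dist.prodVia E' (K (E c).1) (K' (E c).2)) =
      Dist.prodVia E' (μ.bind K) (ν.bind K') :=
  stdSimplex.ext <| funext fun c => by
    simp only [Dist.bind_apply, Dist.prodVia_apply]
    rw [Dist.expect_prodVia E μ ν fun a => K a.1 (E' c).1 * K' a.2 (E' c).2]
    refine (Dist.expect_congr fun a _ =>
      (Dist.expect_const_mul ν (K a (E' c).1) fun b => K' b (E' c).2).trans (mul_comm _ _)).trans ?_
    rw [Dist.expect_const_mul, mul_comm]

lemma channelInfo_prodVia [Fintype σ] (E : γ ≃ α × β) (p : Dist σ) (K : Channel σ α) (ν : Dist β) :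
    channelInfo p (fun s => Dist.prodVia E (K s) ν) = channelInfo p K := by
  have hbind : p.bind (fun s => Dist.prodVia E (K s) ν) = Dist.prodVia E (p.bind K) ν :=
    stdSimplex.ext <| funext fun c => by
      simp only [Dist.bind_apply, Dist.prodVia_apply, mul_comm _ (ν _), Dist.expect_const_mul]
  simp only [channelInfo, hbind, relEntropy]
  congr 1 with s
  refine (Dist.expect_prodVia E (K s) ν fun a =>
    Real.log (K s a.1 * ν a.2 / (p.bind K a.1 * ν a.2))).trans ?_
  refine Dist.expect_congr fun a _ => (Dist.expect_congr fun b hb => ?_).trans (ν.expect_const _)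
  rw [mul_div_mul_right _ _ hb.ne']

end Split

section Blocks

/-- The splitting of a word into `q` blocks of length `m` and a rest of length `r`, with the
positions assigned by `e`. -/
def splitWord (α : Type*) {n q m r : ℕ} (e : Fin n ≃ Fin q × Fin m ⊕ Fin r) :
    (Fin n → α) ≃ (Fin q → Fin m → α) × (Fin r → α) :=
  (e.arrowCongr (Equiv.refl α)).trans <| (Equiv.sumArrowEquivProdArrow _ _ α).trans <|
    (Equiv.curry _ _ α).prodCongr (Equiv.refl _)

lemma memoryless_eq_prodVia {α β : Type*} [Fintype β] (W : Channel α β) {n q m r : ℕ}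
    (e : Fin n ≃ Fin q × Fin m ⊕ Fin r) (x : Fin n → α) :
    memoryless W n x = Dist.prodVia (splitWord β e)
      (memoryless (memoryless W m) q (splitWord α e x).1) (memoryless W r (splitWord α e x).2) :=
  stdSimplex.ext <| funext fun y => by
    refine (e.symm.prod_comp fun i => W (x i) (y i)).symm.trans ?_
    rw [Fintype.prod_sum_type, Fintype.prod_prod_type]
    rfl

lemma prodVia_comp_memoryless {κ α β : Type*} [Fintype α] [Fintype β] {n q m r : ℕ}
    (e : Fin n ≃ Fin q × Fin m ⊕ Fin r) (G : Channel κ (Fin q → Fin m → α)) (ν : Dist (Fin r → α))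
    (W : Channel α β) :
    Channel.comp (fun j => Dist.prodVia (splitWord α e) (G j) ν) (memoryless W n) =
      fun j => Dist.prodVia (splitWord β e) (G.comp (memoryless (memoryless W m) q) j)
        (ν.bind (memoryless W r)) := by
  rw [funext (memoryless_eq_prodVia W e)]
  exact funext fun j => Dist.prodVia_bind _ _ _ _ _ _

variable {θ A B C : Type*} [Fintype A] [Fintype B] [Fintype C] [Nonempty A]

lemma Code.IsGood.exists_of_blocks {W : θ → Channel A B} {V : θ → Channel A C} {q m J : ℕ}
    [NeZero J] {ε : ℝ} {c : Code (Fin m → A) (Fin m → B) q J}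
    (hc : c.IsGood (fun t => memoryless (W t) m) (fun t => memoryless (V t) m) ε) {n r : ℕ}
    (e : Fin n ≃ Fin q × Fin m ⊕ Fin r) : ∃ c' : Code A B n J, c'.IsGood W V ε := by
  classical
  refine ⟨⟨fun j => Dist.prodVia (splitWord A e) (c.enc j) (Dist.uniform _),
    fun j => {y | (splitWord B e y).1 ∈ c.dec j}, fun i j hij => disjoint_left.2 fun y hi hj =>
      disjoint_left.1 (c.disjoint i j hij) ((mem_filter_univ y).1 hi) ((mem_filter_univ y).1 hj)⟩,
    fun t j => ?_, fun t => ?_⟩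
  · simp only [prodVia_comp_memoryless, mem_filter_univ]
    rw [Dist.prob_prodVia (splitWord B e) _ _ fun y => y ∉ c.dec j]
    exact hc.1 t j
  · have hleak := hc.2 t
    rw [Code.mutualInfo_leakLaw] at hleak ⊢
    rwa [prodVia_comp_memoryless, channelInfo_prodVia]

/-- The positions of a word of length `n`, grouped into `n / m` blocks of length `m` and a rest. -/
def blockEquiv (n m : ℕ) : Fin n ≃ Fin (n / m) × Fin m ⊕ Fin (n % m) :=
  (finCongr (Nat.div_add_mod' n m).symm).trans <|
    finSumFinEquiv.symm.trans (finProdFinEquiv.symm.sumCongr (Equiv.refl _))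

lemma eventually_mul_div_sub_le {m : ℕ} (hm : 0 < m) (R : ℝ) {ε : ℝ} (hε : 0 < ε) :
    ∀ᶠ n : ℕ in Filter.atTop, n * (R / m - ε) ≤ (n / m : ℕ) * (R - ε / 2) := by
  filter_upwards [tendsto_natCast_atTop_atTop.eventually_ge_atTop (2 * |R| / ε)] with n hn
  rw [div_le_iff₀ hε] at hn
  have hm' : (0 : ℝ) < m := Nat.cast_pos.2 hm
  have hsplit : (n : ℝ) = (n / m : ℕ) * m + (n % m : ℕ) := by
    exact_mod_cast (Nat.div_add_mod' n m).symm
  have hrest : (n % m : ℕ) / (m : ℝ) * R ≤ |R| := by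
    calc (n % m : ℕ) / (m : ℝ) * R ≤ (n % m : ℕ) / (m : ℝ) * |R| := by
          gcongr
          exact le_abs_self R
      _ ≤ |R| := mul_le_of_le_one_left (abs_nonneg R)
          ((div_le_one hm').2 (Nat.cast_le.2 (Nat.mod_lt n hm).le))
  have hq : ((n / m : ℕ) : ℝ) * ε ≤ n * ε := by
    gcongr
    exact Nat.div_le_self n m
  calc n * (R / m - ε) = (n / m : ℕ) * R + (n % m : ℕ) / (m : ℝ) * R - n * ε := by
        rw [mul_sub]
        nth_rw 1 [hsplit]
        field_simp
    _ ≤ (n / m : ℕ) * (R - ε / 2) := by linarith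

theorem EventuallyAchievable.of_blocks {W : θ → Channel A B} {V : θ → Channel A C} {m : ℕ}
    (hm : 0 < m) {R : ℝ}
    (h : EventuallyAchievable (fun t => memoryless (W t) m) (fun t => memoryless (V t) m) R) :
    EventuallyAchievable W V (R / m) := by
  intro ε hε
  filter_upwards [(Nat.tendsto_div_const_atTop hm.ne').eventually (h (ε / 2) (half_pos hε)),
    eventually_mul_div_sub_le hm R hε] with n ⟨J, hJ, c, hc, hrate⟩ hn
  have : NeZero J := ⟨hJ.ne'⟩
  obtain ⟨c', hc'⟩ := hc.exists_of_blocks (blockEquiv n m)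
  exact ⟨J, hJ, c', hc'.mono (half_le_self hε.le), hn.trans hrate⟩

end Blocks

/-! ### The capacity as a limit -/

section Criteria

variable {θ A B C : Type*} [Fintype A] [Fintype B] [Fintype C] {n J : ℕ}

omit [Fintype B] in
lemma Code.leakage_nonneg [NeZero J] (c : Code A B n J) (V : θ → Channel A C) : 0 ≤ c.leakage V :=
  Real.iSup_nonneg fun t => by
    rw [Code.mutualInfo_leakLaw]
    exact div_nonneg (channelInfo_nonneg _ _) (Real.log_pos one_lt_two).le

variable [DecidableEq B]

lemma Code.error_eq (c : Code A B n J) (W : θ → Channel A B) :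
    c.error W = ⨆ t, ⨆ j, (c.enc.comp (memoryless (W t) n) j).prob fun y => y ∉ c.dec j := by
  simp only [Code.error, ← Dist.prob_mem, mem_compl, Channel.comp, Dist.prob_bind]
  rfl

lemma Code.error_nonneg (c : Code A B n J) (W : θ → Channel A B) : 0 ≤ c.error W := by
  rw [Code.error_eq]
  exact Real.iSup_nonneg fun t => Real.iSup_nonneg fun j => Dist.prob_nonneg _ _

lemma Code.isGood_iff [Finite θ] [Nonempty θ] [NeZero J] (c : Code A B n J) (W : θ → Channel A B)
    (V : θ → Channel A C) (ε : ℝ) : c.IsGood W V ε ↔ c.error W ≤ ε ∧ c.leakage V ≤ ε := by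
  rw [Code.error_eq, Code.leakage, ciSup_le_iff (Set.finite_range _).bddAbove,
    ciSup_le_iff (Set.finite_range _).bddAbove]
  simp only [ciSup_le_iff (Set.finite_range _).bddAbove]
  rfl

omit [DecidableEq B] in
lemma Code.IsGood.card_le [Nonempty θ] {W : θ → Channel A B} {V : θ → Channel A C} {ε : ℝ}
    {c : Code A B n J} (hc : c.IsGood W V ε) (hε : ε < 1) : J ≤ Fintype.card B ^ n := by
  have hne (j : Fin J) : (c.dec j).Nonempty := by
    by_contra hempty
    have herr := hc.1 (Classical.arbitrary θ) j
    simp only [not_nonempty_iff_eq_empty.1 hempty, notMem_empty, not_false_eq_true, Dist.prob,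
      if_true, Dist.expect_const] at herr
    exact herr.not_gt hε
  choose y hy using hne
  have hinj : Function.Injective y := fun i j hij => by
    by_contra hne
    exact disjoint_left.1 (c.disjoint i j hne) (hy i) (hij ▸ hy j)
  simpa using Fintype.card_le_of_injective y hinj

end Criteria

-- Diagonal argument: `ε n` is `1 / (k + 1)` for the largest `k ≤ n` with `P (1 / (k + 1)) n`.
lemma exists_tendsto_zero_of_forall_eventually {P : ℝ → ℕ → Prop}
    (h : ∀ ε, 0 < ε → ∀ᶠ n in Filter.atTop, P ε n) :
    ∃ ε : ℕ → ℝ, Filter.Tendsto ε Filter.atTop (nhds 0) ∧ ∀ᶠ n in Filter.atTop, P (ε n) n := by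
  classical
  let Q (n k : ℕ) : Prop := P (1 / (k + 1)) n
  have hlarge (k : ℕ) : ∀ᶠ n in Filter.atTop, Q n k ∧ k ≤ Nat.findGreatest (Q n) n := by
    filter_upwards [h (1 / (k + 1)) (by positivity), Filter.eventually_ge_atTop k] with n hn hkn
    exact ⟨hn, Nat.le_findGreatest hkn hn⟩
  refine ⟨fun n => 1 / (Nat.findGreatest (Q n) n + 1), tendsto_one_div_add_atTop_nhds_zero_nat.comp
    (Filter.tendsto_atTop.2 fun k => (hlarge k).mono fun n hn => hn.2), ?_⟩
  filter_upwards [hlarge 0] with n hn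
  exact Nat.findGreatest_spec (Nat.zero_le n) hn.1

section Capacity

variable {θ A B C : Type*} [Fintype A] [Fintype B] [Fintype C] {W : θ → Channel A B}
  {V : θ → Channel A C} {R R' : ℝ}

lemma EventuallyAchievable.mono (h : EventuallyAchievable W V R) (hR : R' ≤ R) :
    EventuallyAchievable W V R' := fun ε hε =>
  (h ε hε).mono fun n ⟨J, hJ, c, hc, hrate⟩ => ⟨J, hJ, c, hc, le_trans (by gcongr) hrate⟩

lemma EventuallyAchievable.of_forall_lt (h : ∀ R' < R, EventuallyAchievable W V R') :
    EventuallyAchievable W V R := fun ε hε =>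
  (h (R - ε / 2) (sub_lt_self R (half_pos hε)) (ε / 2) (half_pos hε)).mono
    fun n ⟨J, hJ, c, hc, hrate⟩ => ⟨J, hJ, c, hc.mono (half_le_self hε.le), by
      rwa [sub_sub, add_halves] at hrate⟩

variable [Nonempty θ]

lemma EventuallyAchievable.le_logb_card (h : EventuallyAchievable W V R) :
    R ≤ Real.logb 2 (Fintype.card B) := by
  refine le_of_forall_pos_sub_le fun ε hε => ?_
  obtain ⟨n, ⟨J, hJ, c, hc, hrate⟩, hn⟩ := ((h (min ε (1 / 2)) (by positivity)).and
    (Filter.eventually_gt_atTop 0)).exists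
  have hcard : Real.logb 2 J ≤ n * Real.logb 2 (Fintype.card B) := by
    rw [← Real.logb_pow]
    exact Real.logb_le_logb_of_le one_lt_two (Nat.cast_pos.2 hJ)
      (mod_cast hc.card_le ((min_le_right _ _).trans_lt one_half_lt_one))
  have hR := le_of_mul_le_mul_left (hrate.trans hcard) (Nat.cast_pos.2 hn)
  linarith [min_le_left ε (1 / 2)]

lemma Code.IsGood.exists_mem_blockRateGaps {n J : ℕ} [NeZero J] {ε : ℝ} {c : Code A B n J}
    (hc : c.IsGood W V ε) :
    ∃ r ∈ blockRateGaps W V n, (1 - ε) * Real.logb 2 J - 1 - ε ≤ r := by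
  have hlog : 0 < Real.log 2 := Real.log_pos one_lt_two
  refine ⟨_, ⟨J, (Dist.uniform (Fin J)).joint c.enc, rfl⟩, sub_le_sub (le_ciInf fun t => ?_)
    (ciSup_le fun t => ?_)⟩
  · have hfano := fano_inequality c.disjoint (hc.1 t)
    rw [Fintype.card_fin] at hfano
    rw [mutualInfo_outputLaw_joint, le_div_iff₀ hlog, sub_mul, mul_assoc, Real.logb,
      div_mul_cancel₀ _ hlog.ne', one_mul]
    exact hfano
  · rw [mutualInfo_outputLaw_joint, ← Code.mutualInfo_leakLaw]
    exact hc.2 t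

lemma EventuallyAchievable.eventually_exists_lt_blockRateGaps (h : EventuallyAchievable W V R)
    (hR : R' < R) :
    ∀ᶠ n : ℕ in Filter.atTop, ∃ r ∈ blockRateGaps W V n, R' < 1 / (n : ℝ) * r := by
  have hcont : Continuous fun ε : ℝ => (1 - ε) * (R - ε) := by fun_prop
  have hsmall := (hcont.tendsto 0).eventually_const_lt (u := R') (by simpa using hR)
  obtain ⟨ε, hεR, hε0, hε1⟩ := ((hsmall.filter_mono nhdsWithin_le_nhds).and
    (Ioo_mem_nhdsGT one_pos)).exists
  have hlim := (tendsto_const_div_atTop_nhds_zero_nat (1 + ε)).const_sub ((1 - ε) * (R - ε))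
  rw [sub_zero] at hlim
  filter_upwards [h ε hε0, hlim.eventually_const_lt hεR, Filter.eventually_gt_atTop 0]
    with n ⟨J, hJ, c, hc, hrate⟩ hn hn0
  have : NeZero J := .of_pos hJ
  have hn0' : (0 : ℝ) < n := Nat.cast_pos.2 hn0
  obtain ⟨r, hr, hle⟩ := hc.exists_mem_blockRateGaps
  refine ⟨r, hr, hn.trans_le ?_⟩
  rw [one_div_mul_eq_div, le_div_iff₀ hn0', sub_mul, div_mul_cancel₀ _ hn0'.ne']
  calc (1 - ε) * (R - ε) * n - (1 + ε) = (1 - ε) * (n * (R - ε)) - 1 - ε := by ring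
    _ ≤ (1 - ε) * Real.logb 2 J - 1 - ε := by gcongr
    _ ≤ r := hle

variable [Finite θ] [DecidableEq B]

lemma IsAchievable.eventuallyAchievable (h : IsAchievable W V R) : EventuallyAchievable W V R := by
  obtain ⟨-, J, c, hJ, herr, hrate, hleak⟩ := h
  have (n : ℕ) : NeZero (J n) := .of_pos (hJ n)
  intro ε hε
  filter_upwards [herr.eventually_le_const hε, hleak.eventually_le_const hε,
    Filter.eventually_lt_of_lt_liminf <|
      (EReal.coe_lt_coe_iff.2 (sub_lt_self R hε)).trans_le hrate,
    Filter.eventually_gt_atTop 0] with n hn_err hn_leak hn_rate hn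
  refine ⟨J n, hJ n, c n, ((c n).isGood_iff W V ε).2 ⟨hn_err, hn_leak⟩, ?_⟩
  rw [EReal.coe_lt_coe_iff, one_div_mul_eq_div, lt_div_iff₀' (Nat.cast_pos.2 hn)] at hn_rate
  exact hn_rate.le

variable [Nonempty A]

lemma EventuallyAchievable.isAchievable (h : EventuallyAchievable W V R) (hR : 0 ≤ R) :
    IsAchievable W V R := by
  obtain ⟨ε, hε, hgood⟩ := exists_tendsto_zero_of_forall_eventually h
  have hcode (n : ℕ) : ∃ (J : ℕ) (c : Code A B n J), 0 < J ∧
      ((∃ J, 0 < J ∧ ∃ c : Code A B n J, c.IsGood W V (ε n) ∧ n * (R - ε n) ≤ Real.logb 2 J) →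
        c.IsGood W V (ε n) ∧ n * (R - ε n) ≤ Real.logb 2 J) := by
    by_cases hn : ∃ J, 0 < J ∧ ∃ c : Code A B n J,
        c.IsGood W V (ε n) ∧ n * (R - ε n) ≤ Real.logb 2 J
    · obtain ⟨J, hJ, c, hc⟩ := hn
      exact ⟨J, c, hJ, fun _ => hc⟩
    · obtain ⟨c, -⟩ := exists_isGood_one W V n zero_le_one
      exact ⟨1, c, one_pos, fun hn' => absurd hn' hn⟩
  choose J c hJ hc using hcode
  have (n : ℕ) : NeZero (J n) := .of_pos (hJ n)
  have hisGood := hgood.mono fun n hn => ((c n).isGood_iff W V (ε n)).1 (hc n hn).1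
  refine ⟨hR, J, c, hJ,
    squeeze_zero' (.of_forall fun n => (c n).error_nonneg W) (hisGood.mono fun n hn => hn.1) hε, ?_,
    squeeze_zero' (.of_forall fun n => (c n).leakage_nonneg V) (hisGood.mono fun n hn => hn.2) hε⟩
  have hlim : Filter.Tendsto (fun n => ((R - ε n : ℝ) : EReal)) Filter.atTop (nhds (R : EReal)) :=
    (continuous_coe_real_ereal.tendsto R).comp (by simpa only [sub_zero] using hε.const_sub R)
  rw [← hlim.liminf_eq]
  refine Filter.liminf_le_liminf ?_
  filter_upwards [hgood, Filter.eventually_gt_atTop 0] with n hn hn0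
  rw [EReal.coe_le_coe_iff, one_div_mul_eq_div, le_div_iff₀' (Nat.cast_pos.2 hn0)]
  exact (hc n hn).2

lemma isAchievable_zero (W : θ → Channel A B) (V : θ → Channel A C) : IsAchievable W V 0 :=
  EventuallyAchievable.isAchievable (fun ε hε => .of_forall fun n =>
    have ⟨c, hc⟩ := exists_isGood_one W V n hε.le
    ⟨1, one_pos, c, hc, by
      simpa using mul_nonneg n.cast_nonneg hε.le⟩) le_rfl

lemma isGreatest_secrecyCapacity (W : θ → Channel A B) (V : θ → Channel A C) :
    IsGreatest {R | IsAchievable W V R} (secrecyCapacity W V) := by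
  have hbdd : BddAbove {R | IsAchievable W V R} :=
    ⟨Real.logb 2 (Fintype.card B), fun R hR => IsAchievable.eventuallyAchievable hR |>.le_logb_card⟩
  refine ⟨EventuallyAchievable.isAchievable (.of_forall_lt fun R' hR' => ?_)
    (le_csSup hbdd (isAchievable_zero W V)), fun R hR => le_csSup hbdd hR⟩
  obtain ⟨R, hR, hlt⟩ := exists_lt_of_lt_csSup ⟨0, isAchievable_zero W V⟩ hR'
  exact (IsAchievable.eventuallyAchievable hR).mono hlt.le

lemma EventuallyAchievable.le_secrecyCapacity (h : EventuallyAchievable W V R) :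
    R ≤ secrecyCapacity W V := by
  have hgreatest := isGreatest_secrecyCapacity W V
  rcases le_total 0 R with hR | hR
  · exact hgreatest.2 (h.isAchievable hR)
  · exact hR.trans hgreatest.1.1

theorem tendsto_blockRateGaps (W : θ → Channel A B) (V : θ → Channel A C) {M : ℕ → ℝ}
    (hM : ∀ n, IsGreatest (blockRateGaps W V n) (M n)) :
    Filter.Tendsto (fun n : ℕ => 1 / (n : ℝ) * M n) Filter.atTop (nhds (secrecyCapacity W V)) := by
  have hupper : ∀ᶠ n : ℕ in Filter.atTop, 1 / (n : ℝ) * M n ≤ secrecyCapacity W V := by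
    filter_upwards [Filter.eventually_gt_atTop 0] with n hn
    obtain ⟨k, P, hP⟩ := (hM n).1
    rw [hP, one_div_mul_eq_div]
    exact ((eventuallyAchievable_rateGap _ _ P).of_blocks hn).le_secrecyCapacity
  refine tendsto_order.2 ⟨fun R hR => ?_, fun R hR => hupper.mono fun n hn => hn.trans_lt hR⟩
  filter_upwards [(isGreatest_secrecyCapacity W V).1.eventuallyAchievable
    |>.eventually_exists_lt_blockRateGaps hR] with n ⟨r, hr, hlt⟩
  exact hlt.trans_le (mul_le_mul_of_nonneg_left ((hM n).2 hr) (by positivity))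

end Capacity

/-! ### Existence of the maximum -/

section Entropy

variable {α β σ υ : Type*} [Fintype α] [Fintype β] [Fintype σ] [Fintype υ]

/-- The Shannon entropy in nats. -/
noncomputable def Dist.entropy (μ : Dist α) : ℝ := ∑ a, Real.negMulLog (μ a)

lemma Dist.entropy_eq_expect (μ : Dist α) : μ.entropy = μ.expect fun a => -Real.log (μ a) :=
  sum_congr rfl fun _ _ => neg_mul_comm _ _

lemma channelInfo_eq_entropy_sub (p : Dist σ) (W : Channel σ β) :
    channelInfo p W = (p.bind W).entropy - p.expect fun s => (W s).entropy := by
  rw [channelInfo, Dist.entropy_eq_expect, Dist.expect_bind, ← Dist.expect_sub]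
  refine Dist.expect_congr fun s hs => ?_
  rw [relEntropy, Dist.entropy_eq_expect, ← Dist.expect_sub]
  refine Dist.expect_congr fun b hb => ?_
  rw [Real.log_div hb.ne' (Dist.bind_apply_pos hs hb).ne']
  ring

lemma channelInfo_comp (p : Dist υ) (G : Channel υ α) (W : Channel α β) :
    channelInfo p (G.comp W) =
      ((p.bind G).bind W).entropy - p.expect fun u => (G.comp W u).entropy := by
  rw [channelInfo_eq_entropy_sub, Dist.bind_assoc]
  rfl

lemma Dist.continuous_eval (a : α) : Continuous fun μ : Dist α => μ a :=
  (continuous_apply a).comp continuous_subtype_val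

lemma Dist.continuous_entropy : Continuous (Dist.entropy : Dist α → ℝ) :=
  continuous_finsetSum _ fun a _ => Real.continuous_negMulLog.comp (Dist.continuous_eval a)

lemma Dist.continuous_bind : Continuous fun x : Dist σ × Channel σ β => x.1.bind x.2 :=
  continuous_induced_rng.2 <| continuous_pi fun b => continuous_finsetSum _ fun s _ =>
    ((Dist.continuous_eval s).comp continuous_fst).mul <|
      (Dist.continuous_eval b).comp <| (continuous_apply s).comp continuous_snd

lemma continuous_channelInfo_comp (W : Channel α β) :
    Continuous fun x : Dist υ × Channel υ α => channelInfo x.1 (x.2.comp W) := by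
  have hout {X : Type _} [TopologicalSpace X] {f : X → Dist α} (hf : Continuous f) :
      Continuous fun x => ((f x).bind W).entropy :=
    Dist.continuous_entropy.comp (Dist.continuous_bind.comp (hf.prodMk continuous_const))
  simp only [channelInfo_comp]
  exact (hout Dist.continuous_bind).sub <| continuous_finsetSum _ fun u _ =>
    ((Dist.continuous_eval u).comp continuous_fst).mul <|
      hout ((continuous_apply u).comp continuous_snd)

-- Carathéodory's theorem for the points `(F j v)_j`, whose convex hull holds the expectations.
lemma Dist.exists_expect_eq {ι : Type*} [Fintype ι] (p : Dist υ) (F : ι → υ → ℝ) :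
    ∃ k ≤ Fintype.card ι + 1, ∃ (q : Dist (Fin k)) (u : Fin k → υ),
      ∀ j, (q.expect fun i => F j (u i)) = p.expect (F j) := by
  have hmem : ∑ v, p v • (fun j => F j v) ∈ convexHull ℝ (Set.range fun v j => F j v) :=
    mem_convexHull_of_exists_fintype p _ (stdSimplex.zero_le p) (stdSimplex.sum_eq_one p)
      Set.mem_range_self rfl
  obtain ⟨κ, _, z, w, hz, hind, hw, hw1, hwz⟩ := eq_pos_convex_span_of_mem_convexHull hmem
  choose u hu using fun i => hz (Set.mem_range_self i)
  let e := (Fintype.equivFin κ).symm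
  refine ⟨Fintype.card κ, ?_, ⟨w ∘ e, fun i => (hw _).le, (e.sum_comp w).trans hw1⟩, u ∘ e,
    fun j => ?_⟩
  · rw [← Module.finrank_fintype_fun_eq_card (R := ℝ) (η := ι)]
    exact hind.card_le_finrank_succ.trans (Nat.succ_le_succ (Submodule.finrank_le _))
  · have hj := congrFun hwz j
    simp only [← hu, Finset.sum_apply, Pi.smul_apply, smul_eq_mul] at hj
    exact (e.sum_comp fun i => w i * F j (u i)).trans hj

end Entropy

section Maximum

variable {θ A B C υ : Type*} [Fintype A] [Fintype B] [Fintype C] [Fintype υ]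

lemma rateGap_joint (W : θ → Channel A B) (V : θ → Channel A C) (p : Dist υ) (G : Channel υ A) :
    rateGap W V (p.joint G) = (⨅ t, channelInfo p (G.comp (W t)) / Real.log 2) -
      ⨆ t, channelInfo p (G.comp (V t)) / Real.log 2 := by
  simp only [rateGap, mutualInfo_outputLaw_joint]

lemma continuous_rateGap_joint [Finite θ] [Nonempty θ] (W : θ → Channel A B)
    (V : θ → Channel A C) :
    Continuous fun x : Dist υ × Channel υ A => rateGap W V (x.1.joint x.2) := by
  have := Fintype.ofFinite θ
  simp only [rateGap_joint, ← inf'_univ_eq_ciInf, ← sup'_univ_eq_ciSup]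
  exact (Continuous.finset_inf'_apply _ fun t _ =>
      (continuous_channelInfo_comp (W t)).div_const _).sub
    (Continuous.finset_sup'_apply _ fun t _ => (continuous_channelInfo_comp (V t)).div_const _)

lemma exists_rateGap_joint_eq [Fintype θ] (W : θ → Channel A B) (V : θ → Channel A C) (p : Dist υ)
    (G : Channel υ A) :
    ∃ k ≤ Fintype.card (A ⊕ θ ⊕ θ) + 1, ∃ (q : Dist (Fin k)) (H : Channel (Fin k) A),
      rateGap W V (q.joint H) = rateGap W V (p.joint G) := by
  obtain ⟨k, hk, q, u, hq⟩ := p.exists_expect_eq <|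
    Sum.elim (fun a v => G v a) <| Sum.elim (fun t v => (G.comp (W t) v).entropy)
      fun t v => (G.comp (V t) v).entropy
  refine ⟨k, hk, q, G ∘ u, ?_⟩
  have hbind : q.bind (G ∘ u) = p.bind G := stdSimplex.ext <| funext fun a => hq (.inl a)
  have hW (t : θ) : channelInfo q (Channel.comp (G ∘ u) (W t)) = channelInfo p (G.comp (W t)) := by
    rw [channelInfo_comp, channelInfo_comp, hbind]
    exact congrArg _ (hq (.inr (.inl t)))
  have hV (t : θ) : channelInfo q (Channel.comp (G ∘ u) (V t)) = channelInfo p (G.comp (V t)) := by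
    rw [channelInfo_comp, channelInfo_comp, hbind]
    exact congrArg _ (hq (.inr (.inr t)))
  simp only [rateGap_joint, hW, hV]

lemma rateGaps_eq_biUnion_range [Fintype θ] [Nonempty A] (W : θ → Channel A B)
    (V : θ → Channel A C) :
    rateGaps W V = ⋃ k ∈ Set.Iic (Fintype.card (A ⊕ θ ⊕ θ) + 1),
      Set.range fun x : Dist (Fin k) × Channel (Fin k) A => rateGap W V (x.1.joint x.2) := by
  refine Set.Subset.antisymm ?_ (Set.iUnion₂_subset fun k _ => ?_)
  · rintro _ ⟨_, P, rfl⟩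
    obtain ⟨p, G, rfl⟩ := P.exists_eq_joint
    obtain ⟨k, hk, q, H, hqH⟩ := exists_rateGap_joint_eq W V p G
    exact Set.mem_biUnion hk ⟨(q, H), hqH⟩
  · rintro _ ⟨x, rfl⟩
    exact ⟨k, _, rfl⟩

theorem exists_isGreatest_rateGaps [Finite θ] [Nonempty θ] [Nonempty A] (W : θ → Channel A B)
    (V : θ → Channel A C) : ∃ M, IsGreatest (rateGaps W V) M := by
  have := Fintype.ofFinite θ
  have hcompact : IsCompact (rateGaps W V) := by
    rw [rateGaps_eq_biUnion_range]
    exact (Set.finite_Iic _).isCompact_biUnion fun k _ =>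
      isCompact_range (continuous_rateGap_joint W V)
  exact hcompact.exists_isGreatest ⟨_, 1, Dist.uniform _, rfl⟩

end Maximum

end CompoundWiretap

/-- The first conjunct says that the secrecy capacity is indeed the largest achievable secrecy
rate; the second and third say that the maxima over `U` exist. -/
theorem theorem2 {θ A B C : Type*} [Fintype θ] [Nonempty θ] [Fintype A] [Nonempty A]
    [Fintype B] [DecidableEq B] [Fintype C]
    (W : θ → CompoundWiretap.Channel A B) (V : θ → CompoundWiretap.Channel A C) :
    IsGreatest {R | CompoundWiretap.IsAchievable W V R} (CompoundWiretap.secrecyCapacity W V) ∧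
    (∃ M : ℝ, IsGreatest (CompoundWiretap.rateGaps W V) M ∧
      M ≤ CompoundWiretap.secrecyCapacity W V) ∧
    ∃ M : ℕ → ℝ, (∀ n, IsGreatest (CompoundWiretap.blockRateGaps W V n) (M n)) ∧
      ∃ L : ℝ, Filter.Tendsto (fun n : ℕ => 1 / (n : ℝ) * M n) Filter.atTop (nhds L) ∧
        L ≤ CompoundWiretap.secrecyCapacity W V ∧
        CompoundWiretap.secrecyCapacity W V ≤ L := by
  refine ⟨CompoundWiretap.isGreatest_secrecyCapacity W V, ?_, ?_⟩
  · obtain ⟨M, hM⟩ := CompoundWiretap.exists_isGreatest_rateGaps W V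
    obtain ⟨k, P, hP⟩ := hM.1
    refine ⟨M, hM, ?_⟩
    rw [hP]
    exact (CompoundWiretap.eventuallyAchievable_rateGap W V P).le_secrecyCapacity
  · choose M hM using fun n => CompoundWiretap.exists_isGreatest_rateGaps
      (fun t => CompoundWiretap.memoryless (W t) n) (fun t => CompoundWiretap.memoryless (V t) n)
    exact ⟨M, hM, _, CompoundWiretap.tendsto_blockRateGaps W V hM, le_rfl, le_rfl⟩
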